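/- **Definitions.** Let $\square$ be the category with objects the natural numbers and morphisms generated by $d^\eta_{n,i}:n\to n+1$ ($\eta\in\{-,+\}$, $0\le i\le n$) subject to $d^{\eta'}_{n+1,j}d^{\eta}_{n,i}=d^{\eta}_{n+1,i}d^{\eta'}_{n,j-1}$ for $0\le i<j\le n+1$; equivalently, a morphism $m\to n$ is a word of length $n$ in $\{0,-,+\}$ with exactly $m$ letters $0$, composition being substitution for the letters $0$. A *relational precubical set* $P$ is a lax functor $\square^{op}\to\mathbf{Rel}$: sets $P(k)$ of $k$-cubes and, for every $f:m\to k$ in $\square$, a relation $a\to_f b$ between $a\in P(k)$ and $b\in P(m)$, such that $a\to_{\mathrm{id}}a$, and $a\to_f b$, $b\to_g c$ imply $a\to_{f\circ g}c$. Morphisms are families of functions preserving the relations. The tensor product $P\otimes Q$ has $(P\otimes Q)(k)=\bigsqcup_{i+j=k}P(i)\times Q(j)$, with $(a,b)\to_{g\otimes h}(a',b')$ iff $a\to_g a'$ and $b\to_h b'$, where $g\otimes h$ is the concatenation of words. For a cube $c$ of $P$, its *upward neighborhood* $\uparrow c$ has as cubes the pairs $(d,f)$ with $d\to_f c$ in $P$,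 and as relations $(d',g\circ f)\to_g(d,f)$ whenever $d'\to_g d$ in $P$. Let $V_0$ be the graph with one edge $p_0$, and $V_1$ the graph with two consecutive edges and central vertex $p_1$. Fix $n\in\mathbb N$. For $\epsilon\in\{0,1\}^n$ let $c(\epsilon)=(p_{\epsilon_1},\dots,p_{\epsilon_n})$, a cube of $V_{\epsilon_1}\otimes\cdots\otimes V_{\epsilon_n}$. The *euclidean brick* is $B_\epsilon=\uparrow c(\epsilon)$; its *minimal cube* $\min(B_\epsilon)=(c(\epsilon),\mathrm{id})$ has dimension $|\{i:\epsilon_i=0\}|$. Let $i_\epsilon:B_\epsilon\setminus\{\min(B_\epsilon)\}\hookrightarrow B_\epsilon$ be the inclusion of all the other cubes, with all the relations between them, and let $I=\{i_\epsilon\}\cup\{\nabla_{i_\epsilon}\}$ ($\epsilon\in\{0,1\}^n$), where $\nabla_i=(\mathrm{id},\mathrm{id}):b\sqcup_a b\to b$ is the codiagonal of $i:a\to b$. Write $I^\boxslash$ and ${}^\boxslash I$ for the classes of morphisms with the right, respectively left, lifting property with respect to $I$. A morphism $\alpha:P\to Q$ is a *local embedding* if $\alpha(a)\neq\alpha(b)$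 for all distinct cubes $a,b$ of $P$ such that $a\to_f c$ and $b\to_f c$ for some cube $c$ of $P$ and some $f$. $P$ is *$n$-euclidean* if for every cube $c$ of $P$ there are $\epsilon\in\{0,1\}^n$ and a surjective local embedding $B_\epsilon\to\uparrow c$. For $w\in\{+,-,0,1\}^n$ such that $w_i=0$ if and only if $\epsilon_i=0$, let $p(w)\in\{0,1\}^n$ be given by $p(w)_i=1$ iff $w_i=1$, and let $\iota_w:B_{p(w)}\to B_\epsilon$ be the morphism induced by the tensor product of the maps $V_{p(w)_i}\to V_{\epsilon_i}$ equal to the identity if $w_i\in\{0,1\}$, to the inclusion of the first edge if $w_i=-$, and to the inclusion of the second edge if $w_i=+$. The *blowup* $\tilde P$ of $P$ has as $k$-cubes the morphisms $B_\epsilon\to P$, for all $\epsilon\in\{0,1\}^n$ with $|\{i:\epsilon_i=0\}|=k$; its relations are $f\circ\iota_w\to_g f$ for $f:B_\epsilon\to P$ and $w$ as above with $\iota_w(\min(B_{p(w)}))\to_g\min(B_\epsilon)$ in $B_\epsilon$. The *blowup map* $\beta_P:\tilde P\to P$ sends $f:B_\epsilon\to P$ to $f(\min(B_\epsilon))$.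 **Theorem.** For every $n\in\mathbb N$, there is a model structure on the category of relational precubical sets whose cofibrations are ${}^\boxslash(I^\boxslash)$, whose weak equivalences are $I^\boxslash$, and in which every morphism is a fibration. For this model structure: 1. A relational precubical set is cofibrant if and only if it is $n$-euclidean. 2. For every relational precubical set $P$, the blowup map $\beta_P:\tilde P\to P$ is the cofibrant replacement of $P$: $\tilde P$ is cofibrant, $\beta_P$ is a trivial fibration, and for every trivial fibration $q:Q\to P$ with $Q$ cofibrant there is a unique isomorphism $e:Q\cong\tilde P$ with $\beta_P\circ e=q$. -/

import Mathlib

open CategoryTheory Limits HomotopicalAlgebra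

universe w v u

/-! ## Relational presheaves -/

/-- A relational presheaf on `C`: a lax functor from `Cᵒᵖ` to sets and relations, in concrete terms.
`rel f a b` is written `a →_f b` in the comments. Being lax, it may have `a →_𝟙 b` with `a ≠ b`. -/
structure RelPresheaf (C : Type u) [Category.{v} C] where
  obj : C → Type w
  rel : ∀ {c d : C}, (d ⟶ c) → obj c → obj d → Prop
  rel_id : ∀ {c : C} (x : obj c), rel (𝟙 c) x x
  rel_comp : ∀ {c d e : C} {f : d ⟶ c} {g : e ⟶ d} {x : obj c} {y : obj d} {z : obj e},
    rel f x y → rel g y z → rel (g ≫ f) x z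

namespace RelPresheaf

variable {C : Type u} [Category.{v} C]

/-- A morphism of relational presheaves (an oplax natural transformation whose components are
functions). -/
@[ext]
structure Hom (P Q : RelPresheaf.{w} C) where
  app : ∀ c : C, P.obj c → Q.obj c
  map_rel : ∀ {c d : C} {f : d ⟶ c} {x : P.obj c} {y : P.obj d},
    P.rel f x y → Q.rel f (app c x) (app d y)

instance : Category (RelPresheaf.{w} C) where
  Hom := Hom
  id _ := ⟨fun _ x => x, fun h => h⟩
  comp α β := ⟨fun c x => β.app c (α.app c x), fun h => β.map_rel (α.map_rel h)⟩

@[ext]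
theorem hom_ext {P Q : RelPresheaf.{w} C} {α β : P ⟶ Q}
    (h : ∀ (c : C) (x : P.obj c), α.app c x = β.app c x) : α = β :=
  Hom.ext (funext fun c => funext fun x => h c x)

@[simp]
theorem id_app (P : RelPresheaf.{w} C) (c : C) (x : P.obj c) : Hom.app (𝟙 P) c x = x := rfl

@[simp]
theorem comp_app {P Q R : RelPresheaf.{w} C} (α : P ⟶ Q) (β : Q ⟶ R) (c : C) (x : P.obj c) :
    Hom.app (α ≫ β) c x = β.app c (α.app c x) := rfl

/-- The relational subpresheaf on the given cells, with all the relations between them. -/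
def restrict (P : RelPresheaf.{w} C) (S : ∀ c : C, Set (P.obj c)) : RelPresheaf.{w} C where
  obj c := {x : P.obj c // x ∈ S c}
  rel f x y := P.rel f x.1 y.1
  rel_id x := P.rel_id x.1
  rel_comp h h' := P.rel_comp h h'

/-- The inclusion of a relational subpresheaf. -/
def restrictIncl (P : RelPresheaf.{w} C) (S : ∀ c : C, Set (P.obj c)) : P.restrict S ⟶ P :=
  Hom.mk (fun _ x => x.1) (fun h => h)

/-- The upward neighborhood `↑c` of a cell `c`: its cells are the pairs `(d, f)` with `d →_f c`, and
its relations are `(d', f ≫ g) →_g (d, f)` for `d' →_g d` in `P`. -/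
def up (P : RelPresheaf.{w} C) {m : C} (c : P.obj m) : RelPresheaf.{max w v} C where
  obj k := {x : P.obj k × (m ⟶ k) // P.rel x.2 x.1 c}
  rel g x y := x.1.2 = y.1.2 ≫ g ∧ P.rel g x.1.1 y.1.1
  rel_id x := ⟨(Category.comp_id _).symm, P.rel_id _⟩
  rel_comp {_ _ _ f g x y z} h h' := ⟨by rw [h.1, h'.1, Category.assoc], P.rel_comp h.2 h'.2⟩

/-! ### Colimits of relational presheaves -/

section Colimits

variable {J : Type} [SmallCategory J]

/-- Evaluation at an object, as a functor. -/
def evaluation (c : C) : RelPresheaf.{w} C ⥤ Type w where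
  obj P := P.obj c
  map α := TypeCat.ofHom (Hom.app α c)

/-- The relations of a colimit are generated by those of the diagram, under reflexivity and
transitivity. -/
inductive ColimitRel (D : J ⥤ RelPresheaf.{w} C) : ∀ {c d : C}, (d ⟶ c) →
    colimit (D ⋙ evaluation c) → colimit (D ⋙ evaluation d) → Prop
  | of {c d : C} {f : d ⟶ c} (j : J) (x : (D.obj j).obj c) (y : (D.obj j).obj d)
      (h : (D.obj j).rel f x y) :
      ColimitRel D f (colimit.ι (D ⋙ evaluation c) j x) (colimit.ι (D ⋙ evaluation d) j y)
  | refl {c : C} (x : colimit (D ⋙ evaluation c)) : ColimitRel D (𝟙 c) x x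
  | comp {c d e : C} {f : d ⟶ c} {g : e ⟶ d} {x : colimit (D ⋙ evaluation c)}
      {y : colimit (D ⋙ evaluation d)} {z : colimit (D ⋙ evaluation e)} :
      ColimitRel D f x y → ColimitRel D g y z → ColimitRel D (g ≫ f) x z

/-- The colimit of a diagram of relational presheaves. -/
noncomputable def colimitObj (D : J ⥤ RelPresheaf.{w} C) : RelPresheaf.{w} C where
  obj c := colimit (D ⋙ evaluation c)
  rel f x y := ColimitRel D f x y
  rel_id x := .refl x
  rel_comp h h' := .comp h h'

/-- The colimit cocone. -/
noncomputable def colimitCocone (D : J ⥤ RelPresheaf.{w} C) : Cocone D where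
  pt := colimitObj D
  ι :=
    { app := fun j => Hom.mk (fun c x => colimit.ι (D ⋙ evaluation c) j x)
        (fun h => .of j _ _ h)
      naturality := fun i j f => by
        ext c x
        exact ConcreteCategory.congr_hom (colimit.w (D ⋙ evaluation c) f) x }

/-- The cocone of sets induced by a cocone of relational presheaves. -/
def evalCocone {D : J ⥤ RelPresheaf.{w} C} (s : Cocone D) (c : C) :
    Cocone (D ⋙ evaluation c) := (evaluation c).mapCocone s

theorem desc_rel {D : J ⥤ RelPresheaf.{w} C} (s : Cocone D) {c d : C} {f : d ⟶ c}
    {x : colimit (D ⋙ evaluation c)} {y : colimit (D ⋙ evaluation d)} (h : ColimitRel D f x y) :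
    s.pt.rel f (colimit.desc _ (evalCocone s c) x) (colimit.desc _ (evalCocone s d) y) := by
  induction h with
  | @of c d f j x y h =>
    have h1 := ConcreteCategory.congr_hom (colimit.ι_desc (evalCocone s c) j) x
    have h2 := ConcreteCategory.congr_hom (colimit.ι_desc (evalCocone s d) j) y
    exact (congrArg₂ (s.pt.rel f) h1 h2).mpr (Hom.map_rel (s.ι.app j) h)
  | refl x => exact s.pt.rel_id _
  | comp _ _ h h' => exact s.pt.rel_comp h h'

/-- The colimit cocone is universal. -/
noncomputable def colimitCoconeIsColimit (D : J ⥤ RelPresheaf.{w} C) :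
    IsColimit (colimitCocone D) where
  desc s := Hom.mk (fun c => colimit.desc (D ⋙ evaluation c) (evalCocone s c))
    (fun h => desc_rel s h)
  fac s j := by
    ext c x
    exact ConcreteCategory.congr_hom (colimit.ι_desc (evalCocone s c) j) x
  uniq s m hm := by
    ext c x
    have h : TypeCat.ofHom (Hom.app m c) = colimit.desc (D ⋙ evaluation c) (evalCocone s c) := by
      refine colimit.hom_ext fun j => ?_
      refine Eq.trans ?_ (colimit.ι_desc (evalCocone s c) j).symm
      ext y
      exact congrArg (fun α => Hom.app α c y) (hm j)
    exact ConcreteCategory.congr_hom h x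

instance : HasColimitsOfShape J (RelPresheaf.{w} C) :=
  ⟨fun D => ⟨⟨⟨_, colimitCoconeIsColimit D⟩⟩⟩⟩

end Colimits

end RelPresheaf

/-! ## The cube category -/

/-- Words in `{0, -, +}`: `none` is the letter `0`, `some false` is `-`, `some true` is `+`. -/
abbrev FaceWord := List (Option Bool)

/-- `fill w v` replaces the successive letters `0` of `v` by the successive letters of `w`. -/
def fill : FaceWord → FaceWord → FaceWord
  | _, [] => []
  | w, some s :: v => some s :: fill w v
  | [], none :: _ => []
  | a :: w, none :: v => a :: fill w v

theorem fill_length : ∀ w v : FaceWord, w.length = v.count none →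
    (fill w v).length = v.length
  | _, [], _ => by simp [fill]
  | w, some s :: v, h => by simp_all [fill, fill_length w v]
  | [], none :: _, h => by simp at h
  | a :: w, none :: v, h => by simp_all [fill, fill_length w v]

theorem fill_count : ∀ w v : FaceWord, w.length = v.count none →
    (fill w v).count none = w.count none
  | [], [], _ => by simp [fill]
  | _ :: _, [], h => by simp at h
  | w, some s :: v, h => by simp_all [fill, fill_count w v]
  | [], none :: _, h => by simp at h
  | a :: w, none :: v, h => by simp_all [fill, fill_count w v, List.count_cons]

theorem fill_replicate_left : ∀ v : FaceWord,
    fill (List.replicate (v.count none) none) v = v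
  | [] => by simp [fill]
  | some s :: v => by simp [fill, fill_replicate_left v]
  | none :: v => by simp [fill, List.replicate_succ, fill_replicate_left v]

theorem fill_replicate_right : ∀ w : FaceWord,
    fill w (List.replicate w.length none) = w
  | [] => by simp [fill]
  | a :: w => by simp [fill, List.replicate_succ, fill_replicate_right w]

theorem fill_assoc : ∀ w v t : FaceWord, w.length = v.count none → v.length = t.count none →
    fill (fill w v) t = fill w (fill v t)
  | _, _, [], _, _ => by simp [fill]
  | w, v, some s :: t, h, h' => by simp_all [fill, fill_assoc w v t]
  | _, [], none :: _, _, h' => by simp at h'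
  | w, some s :: v, none :: t, h, h' => by simp_all [fill, fill_assoc w v t]
  | [], none :: _, none :: _, h, _ => by simp at h
  | a :: w, none :: v, none :: t, h, h' => by simp_all [fill, fill_assoc w v t]

theorem fill_append : ∀ w v w' v' : FaceWord, w.length = v.count none →
    fill (w ++ w') (v ++ v') = fill w v ++ fill w' v'
  | [], [], _, _, _ => by simp [fill]
  | _ :: _, [], _, _, h => by simp at h
  | w, some s :: v, w', v', h => by simp_all [fill, fill_append w v w' v']
  | [], none :: _, _, _, h => by simp at h
  | a :: w, none :: v, w', v', h => by simp_all [fill, fill_append w v w' v']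

/-- The objects of the cube category `□`: the natural numbers. -/
@[ext]
structure CubeCat where
  dim : ℕ

/-- A morphism `m ⟶ n` of `□`, as its normal form: a word of length `n` in `{0, -, +}` with exactly
`m` letters `0`. The letter `±` in position `i` stands for the face `d^±` in direction `i`. -/
@[ext]
structure CubeHom (m n : CubeCat) where
  word : FaceWord
  length_eq : word.length = n.dim
  count_eq : word.count none = m.dim

instance : Category CubeCat where
  Hom := CubeHom
  id n := ⟨List.replicate n.dim none, by simp, by simp⟩
  comp f g := ⟨fill f.word g.word,
    by rw [fill_length _ _ (f.length_eq.trans g.count_eq.symm), g.length_eq],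
    by rw [fill_count _ _ (f.length_eq.trans g.count_eq.symm), f.count_eq]⟩
  id_comp f := CubeHom.ext (by simp only [← f.count_eq]; exact fill_replicate_left _)
  comp_id f := CubeHom.ext (by simp only [← f.length_eq]; exact fill_replicate_right _)
  assoc f g h := CubeHom.ext (fill_assoc _ _ _ (f.length_eq.trans g.count_eq.symm)
    (g.length_eq.trans h.count_eq.symm))

namespace CubeCat

@[ext]
theorem hom_ext {m n : CubeCat} {f g : m ⟶ n} (h : f.word = g.word) : f = g := CubeHom.ext h

@[simp]
theorem id_word (n : CubeCat) : CubeHom.word (𝟙 n) = List.replicate n.dim none := rfl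

@[simp]
theorem comp_word {m n p : CubeCat} (f : m ⟶ n) (g : n ⟶ p) :
    CubeHom.word (f ≫ g) = fill f.word g.word := rfl

theorem hom_self_eq_id {n : CubeCat} (f : n ⟶ n) : f = 𝟙 n := by
  apply hom_ext
  have h : ∀ a ∈ f.word, none = a := List.count_eq_length.1 (f.count_eq.trans f.length_eq.symm)
  rw [id_word, List.eq_replicate_iff]
  exact ⟨f.length_eq, fun b hb => (h b hb).symm⟩

/-- The generator `d^η_{n,i} : n ⟶ n + 1`, `0 ≤ i ≤ n`, where `η = true` is `+`. -/
def face (η : Bool) (n i : ℕ) (h : i ≤ n) : (⟨n⟩ : CubeCat) ⟶ ⟨n + 1⟩ :=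
  CubeHom.mk (List.replicate i none ++ some η :: List.replicate (n - i) none)
    (by simp; omega) (by simp [List.count_append]; omega)

/-- The defining relations of `□`. -/
theorem face_comp_face (η η' : Bool) (n i j : ℕ) (hij : i < j) (hj : j ≤ n + 1) :
    face η n i (by omega) ≫ face η' (n + 1) j hj =
      face η' n (j - 1) (by omega) ≫ face η (n + 1) i (by omega) := by
  obtain ⟨k, rfl⟩ : ∃ k, j = i + 1 + k := ⟨j - (i + 1), by omega⟩
  obtain ⟨l, rfl⟩ : ∃ l, n = i + k + l := ⟨n - (i + k), by omega⟩
  apply hom_ext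
  have e1 : i + k + l - i = k + l := by omega
  have e2 : i + k + l + 1 - (i + 1 + k) = l := by omega
  have e3 : i + 1 + k - 1 = i + k := by omega
  have e4 : i + k + l - (i + k) = l := by omega
  have e5 : i + k + l + 1 - i = k + (l + 1) := by omega
  have r (w : FaceWord) (n : ℕ) (h : w.length = n) : fill w (List.replicate n none) = w := by
    rw [← h, fill_replicate_right]
  have p (s : Bool) (a b : ℕ) : fill (List.replicate (a + b) none)
      (List.replicate a none ++ some s :: List.replicate b none) =
      List.replicate a none ++ some s :: List.replicate b none := by
    rw [List.replicate_add, fill_append _ _ _ _ (by simp)]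
    simp [fill, r]
  simp only [comp_word, face, e1, e2, e3, e4, e5]
  have q : i + 1 + k = i + (1 + k) := by omega
  rw [q, List.replicate_add (m := i) (n := 1 + k), List.replicate_add (m := i) (n := k),
    List.append_assoc, List.append_assoc, fill_append _ _ _ _ (by simp),
    fill_append _ _ _ _ (by simp)]
  congr 1
  rw [Nat.add_comm 1 k, List.replicate_succ]
  simp only [List.cons_append, fill, p]
  rw [r _ _ (by simp)]

end CubeCat

/-! ## Relational precubical sets and their tensor product -/

/-- Relational precubical sets: relational presheaves on `□`. -/
abbrev RelPrecubicalSet := RelPresheaf.{w} CubeCat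

namespace RelPrecubicalSet

open RelPresheaf

/-- The tensor product: the `n`-cubes of `P ⊗ Q` are the pairs of an `i`-cube of `P` and a `j`-cube
of `Q` with `i + j = n`. The faces of a pair are the pairs of faces, the directions of `P` coming
before those of `Q`. -/
def tensor (P Q : RelPrecubicalSet.{w}) : RelPrecubicalSet.{w} where
  obj n := {x : (Σ i, P.obj i) × (Σ j, Q.obj j) // x.1.1.dim + x.2.1.dim = n.dim}
  rel f x y := ∃ (g : y.1.1.1 ⟶ x.1.1.1) (h : y.1.2.1 ⟶ x.1.2.1), f.word = g.word ++ h.word ∧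
    P.rel g x.1.1.2 y.1.1.2 ∧ Q.rel h x.1.2.2 y.1.2.2
  rel_id {c} x := ⟨𝟙 _, 𝟙 _, by simp [← x.2], P.rel_id _, Q.rel_id _⟩
  rel_comp := by
    rintro c d e f f' x y z ⟨g, h, e1, h1, h2⟩ ⟨g', h', e2, h3, h4⟩
    refine ⟨g' ≫ g, h' ≫ h, ?_, P.rel_comp h1 h3, Q.rel_comp h2 h4⟩
    simp only [CubeCat.comp_word, e1, e2]
    exact fill_append _ _ _ _ (g'.length_eq.trans g.count_eq.symm)

/-- The tensor product of morphisms. -/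
def tensorMap {P P' Q Q' : RelPrecubicalSet.{w}} (α : P ⟶ P') (β : Q ⟶ Q') :
    tensor P Q ⟶ tensor P' Q' :=
  Hom.mk (fun _ x => ⟨(⟨x.1.1.1, α.app _ x.1.1.2⟩, ⟨x.1.2.1, β.app _ x.1.2.2⟩), x.2⟩) (by
    rintro c d f x y ⟨g, h, e, h1, h2⟩
    exact ⟨g, h, e, α.map_rel h1, β.map_rel h2⟩)

theorem tensorMap_id (P Q : RelPrecubicalSet.{w}) : tensorMap (𝟙 P) (𝟙 Q) = 𝟙 _ := rfl

theorem tensorMap_comp {P P' P'' Q Q' Q'' : RelPrecubicalSet.{w}} (α : P ⟶ P') (α' : P' ⟶ P'')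
    (β : Q ⟶ Q') (β' : Q' ⟶ Q'') :
    tensorMap (α ≫ α') (β ≫ β') = tensorMap α β ≫ tensorMap α' β' := rfl

/-- The cubes of the linear graph with `k` consecutive edges. -/
inductive SegmentCell (k : ℕ) : CubeCat → Type w
  | vertex (i : Fin (k + 1)) : SegmentCell k ⟨0⟩
  | edge (i : Fin k) : SegmentCell k ⟨1⟩

/-- The linear graph with `k` consecutive edges, as a precubical set: the source (back face) of the
edge `i` is the vertex `i`, its target (front face) is the vertex `i + 1`. The last three cases
concern identities of `□` and the empty set of morphisms `1 ⟶ 0`. -/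
def SegmentCell.rel {k : ℕ} {m n : CubeCat} (f : m ⟶ n) :
    SegmentCell.{w} k n → SegmentCell.{w} k m → Prop
  | .edge i, .vertex j => (f.word = [some false] ∧ i.castSucc = j) ∨
      (f.word = [some true] ∧ i.succ = j)
  | .vertex i, .vertex j => i = j
  | .edge i, .edge j => i = j
  | .vertex _, .edge _ => False

/-- The linear graph with `k` consecutive edges, as a relational precubical set. -/
def segment (k : ℕ) : RelPrecubicalSet.{w} where
  obj := SegmentCell.{w} k
  rel := SegmentCell.rel
  rel_id x := by cases x <;> simp [SegmentCell.rel]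
  rel_comp {c d e f g x y z} h h' := by
    cases x <;> cases y <;> cases z <;> simp only [SegmentCell.rel] at h h' ⊢
    · exact h.trans h'
    · subst h'
      rwa [CubeCat.hom_self_eq_id g, Category.id_comp]
    · subst h
      rwa [CubeCat.hom_self_eq_id f, Category.comp_id]
    · exact h.trans h'

/-- The unit of the tensor product: one vertex. -/
def point : RelPrecubicalSet.{w} where
  obj n := {_x : PUnit.{w + 1} // n.dim = 0}
  rel _ _ _ := True
  rel_id _ := trivial
  rel_comp _ _ := trivial

/-- `V_0` is the graph with one edge, `V_1` the graph with two consecutive edges. -/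
def V : Bool → RelPrecubicalSet.{w}
  | false => segment 1
  | true => segment 2

/-- The dimension of `p_0` and `p_1`. -/
def middleDim : Bool → CubeCat
  | false => ⟨1⟩
  | true => ⟨0⟩

/-- `p_0` is the edge of `V_0`, `p_1` is the central vertex of `V_1`. -/
def middle : ∀ b : Bool, (V.{w} b).obj (middleDim b)
  | false => SegmentCell.edge 0
  | true => SegmentCell.vertex 1

/-- The two inclusions `V_0 ⟶ V_1`: onto the first edge for `s = false` (the letter `-`), onto the
second edge for `s = true` (the letter `+`). -/
def segmentIncl (s : Bool) : V.{w} false ⟶ V.{w} true :=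
  Hom.mk (fun _ x => match x with
    | .vertex i => .vertex (bif s then i.succ else i.castSucc)
    | .edge i => .edge (bif s then i.succ else i.castSucc)) (by
    rintro c d f x y h
    cases x <;> cases y <;> simp only [V, segment, SegmentCell.rel] at h ⊢
    · rw [h]
    · rcases h with ⟨h, rfl⟩ | ⟨h, rfl⟩
      · exact Or.inl ⟨h, by cases s <;> rfl⟩
      · exact Or.inr ⟨h, by cases s <;> rfl⟩
    · rw [h])

/-! ## Euclidean bricks -/

/-- The closed euclidean brick `V_{ε_1} ⊗ ⋯ ⊗ V_{ε_n}`, where `false` stands for `0` and `true` for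
`1`. -/
def closedBrick : List Bool → RelPrecubicalSet.{w}
  | [] => point
  | b :: ε => tensor (V b) (closedBrick ε)

/-- The dimension of the minimal cube of `B_ε`: the number of indices with `ε_i = 0`. -/
def brickDim (ε : List Bool) : CubeCat := ⟨ε.count false⟩

/-- The cube `c(ε) = (p_{ε_1}, …, p_{ε_n})` of the closed brick. -/
def center : ∀ ε : List Bool, (closedBrick.{w} ε).obj (brickDim ε)
  | [] => ⟨PUnit.unit, rfl⟩
  | b :: ε => ⟨(⟨middleDim b, middle b⟩, ⟨brickDim ε, center ε⟩), by
      cases b <;> simp [middleDim, brickDim, Nat.add_comm]⟩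

/-- The euclidean brick `B_ε = ↑c(ε)`. -/
def brick (ε : List Bool) : RelPrecubicalSet.{w} := up (closedBrick.{w} ε) (center ε)

/-- The minimal cube `min(B_ε)`. -/
def brickMin (ε : List Bool) : (brick.{w} ε).obj (brickDim ε) :=
  ⟨(center ε, 𝟙 _), (closedBrick ε).rel_id _⟩

/-- The relational precubical set `B_ε ∖ {min(B_ε)}`. -/
def puncturedBrick (ε : List Bool) : RelPrecubicalSet.{w} :=
  (brick.{w} ε).restrict fun k => {x | (⟨k, x⟩ : Σ k, (brick.{w} ε).obj k) ≠ ⟨_, brickMin ε⟩}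

/-- The inclusion `i_ε : B_ε ∖ {min(B_ε)} ⟶ B_ε`. -/
def brickIncl (ε : List Bool) : puncturedBrick.{w} ε ⟶ brick.{w} ε := restrictIncl _ _

/-- The generating cofibrations in dimension `n`: the inclusions `i_ε` for `ε ∈ {0,1}^n` and their
codiagonals. -/
inductive generatingCofibrations (n : ℕ) : MorphismProperty RelPrecubicalSet.{w}
  | incl (ε : List Bool) (hε : ε.length = n) : generatingCofibrations n (brickIncl ε)
  | codiagonal (ε : List Bool) (hε : ε.length = n) :
      generatingCofibrations n (pushout.codiagonal (brickIncl ε))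

/-! ## Euclidean relational precubical sets -/

/-- Local embeddings: two distinct cubes with a common face along the same morphism of `□` have
distinct images. (Such cubes have the same dimension.) -/
def IsLocalEmbedding {P Q : RelPrecubicalSet.{w}} (α : P ⟶ Q) : Prop :=
  ∀ ⦃k : CubeCat⦄ (a b : P.obj k), a ≠ b →
    (∃ (m : CubeCat) (f : m ⟶ k) (c : P.obj m), P.rel f a c ∧ P.rel f b c) →
    α.app k a ≠ α.app k b

/-- `φ : B_ε ⟶ ↑c` is a chart at `c`: a surjective local embedding. -/
def IsChart {P : RelPrecubicalSet.{w}} {m : CubeCat} {c : P.obj m} {ε : List Bool}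
    (φ : brick.{w} ε ⟶ P.up c) : Prop :=
  (∀ k, Function.Surjective (φ.app k)) ∧ IsLocalEmbedding φ

/-- `n`-euclidean relational precubical sets. -/
def IsEuclidean (n : ℕ) (P : RelPrecubicalSet.{w}) : Prop :=
  ∀ ⦃m : CubeCat⦄ (c : P.obj m), ∃ ε : List Bool, ε.length = n ∧
    ∃ φ : brick.{w} ε ⟶ P.up c, IsChart φ

/-! ## The blowup -/

/-- `BrickWord ε' ε` is the set of words `w ∈ {+,-,0,1}^n` in `D_ε` (that is, `w_i = 0` if and only
if `ε_i = 0`) with `p(w) = ε'` (that is, `ε'_i = 1` if and only if `w_i = 1`). -/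
inductive BrickWord : List Bool → List Bool → Type
  | nil : BrickWord [] []
  | zero {ε' ε : List Bool} (v : BrickWord ε' ε) : BrickWord (false :: ε') (false :: ε)
  | one {ε' ε : List Bool} (v : BrickWord ε' ε) : BrickWord (true :: ε') (true :: ε)
  | sign (s : Bool) {ε' ε : List Bool} (v : BrickWord ε' ε) : BrickWord (false :: ε') (true :: ε)

namespace BrickWord

/-- The word `ε` itself, the maximal element of `D_ε`. -/
protected def id : ∀ ε : List Bool, BrickWord ε ε
  | [] => nil
  | false :: ε => zero (BrickWord.id ε)
  | true :: ε => one (BrickWord.id ε)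

/-- The composition of words corresponding to the composition of the inclusions of bricks. -/
def comp : ∀ {ε'' ε' ε : List Bool}, BrickWord ε'' ε' → BrickWord ε' ε → BrickWord ε'' ε
  | _, _, _, nil, nil => nil
  | _, _, _, zero v, zero v' => zero (comp v v')
  | _, _, _, one v, one v' => one (comp v v')
  | _, _, _, sign s v, one v' => sign s (comp v v')
  | _, _, _, zero v, sign s v' => sign s (comp v v')

/-- The inclusion of closed bricks: in the direction `i` it is the identity if `w_i` is `0` or `1`,
and one of the two inclusions `V_0 ⟶ V_1` if `w_i` is `-` or `+`. -/
def closedMap : ∀ {ε' ε : List Bool}, BrickWord ε' ε → (closedBrick.{w} ε' ⟶ closedBrick.{w} ε)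
  | _, _, nil => 𝟙 point
  | _, _, zero v => tensorMap (𝟙 (V false)) (closedMap v)
  | _, _, one v => tensorMap (𝟙 (V true)) (closedMap v)
  | _, _, sign s v => tensorMap (segmentIncl s) (closedMap v)

/-- The letters of `g_w`: the letters `1` of `w` are removed and the signs are reversed. -/
def faceWord : ∀ {ε' ε : List Bool}, BrickWord ε' ε → FaceWord
  | _, _, nil => []
  | _, _, zero v => none :: faceWord v
  | _, _, one v => faceWord v
  | _, _, sign s v => some (!s) :: faceWord v

/-- The morphism `g_w` of `□`. -/
def face {ε' ε : List Bool} (v : BrickWord ε' ε) : brickDim ε ⟶ brickDim ε' :=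
  CubeHom.mk v.faceWord (by induction v <;> simp_all [faceWord, brickDim])
    (by induction v <;> simp_all [faceWord, brickDim])

theorem closedMap_center {ε' ε : List Bool} (v : BrickWord ε' ε) :
    (closedBrick.{w} ε).rel v.face (v.closedMap.app _ (center ε')) (center ε) := by
  induction v with
  | nil => trivial
  | zero v ih => exact ⟨𝟙 _, v.face, rfl, (V false).rel_id _, ih⟩
  | one v ih => exact ⟨𝟙 _, v.face, rfl, (V true).rel_id _, ih⟩
  | sign s v ih =>
    refine ⟨CubeHom.mk [some (!s)] rfl rfl, v.face, rfl, ?_, ih⟩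
    cases s
    · exact Or.inr ⟨rfl, rfl⟩
    · exact Or.inl ⟨rfl, rfl⟩

/-- The inclusion `ι_w : B_{p(w)} ⟶ B_ε`. -/
def incl {ε' ε : List Bool} (v : BrickWord ε' ε) : brick.{w} ε' ⟶ brick.{w} ε :=
  Hom.mk (fun k x => ⟨(v.closedMap.app k x.1.1, v.face ≫ x.1.2),
      (closedBrick ε).rel_comp (v.closedMap.map_rel x.2) v.closedMap_center⟩)
    (fun {_ _ f _ y} h => ⟨(congrArg (v.face ≫ ·) h.1).trans
      (Category.assoc v.face y.1.2 f).symm, v.closedMap.map_rel h.2⟩)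

theorem closedMap_id (ε : List Bool) : (BrickWord.id ε).closedMap = 𝟙 (closedBrick.{w} ε) := by
  induction ε with
  | nil => rfl
  | cons b ε ih => cases b <;> simp only [BrickWord.id, closedMap, ih] <;> rfl

theorem face_id (ε : List Bool) : (BrickWord.id ε).face = 𝟙 _ := by
  apply CubeCat.hom_ext
  induction ε with
  | nil => rfl
  | cons b ε ih =>
    cases b <;> simp_all [BrickWord.id, face, faceWord, brickDim, List.replicate_succ]

theorem closedMap_comp {ε'' ε' ε : List Bool} (v : BrickWord ε'' ε') (v' : BrickWord ε' ε) :
    (v.comp v').closedMap = v.closedMap.{w} ≫ v'.closedMap := by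
  induction v generalizing ε <;> cases v' <;> simp_all [comp, closedMap] <;> rfl

theorem face_comp {ε'' ε' ε : List Bool} (v : BrickWord ε'' ε') (v' : BrickWord ε' ε) :
    (v.comp v').face = v'.face ≫ v.face := by
  apply CubeCat.hom_ext
  induction v generalizing ε <;> cases v' <;> simp_all [comp, face, faceWord, fill]

theorem incl_id (ε : List Bool) : (BrickWord.id ε).incl = 𝟙 (brick.{w} ε) := by
  ext k x
  apply Subtype.ext
  simp only [incl, closedMap_id, face_id]
  simp

theorem incl_comp {ε'' ε' ε : List Bool} (v : BrickWord ε'' ε') (v' : BrickWord ε' ε) :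
    (v.comp v').incl = v.incl.{w} ≫ v'.incl := by
  ext k x
  apply Subtype.ext
  simp only [incl, closedMap_comp, face_comp]
  simp

end BrickWord

/-- The `n`-blowup of `P`: its `k`-cubes are the morphisms `B_ε ⟶ P` where `ε ∈ {0,1}^n` is such
that the minimal cube of `B_ε` has dimension `k`, and its relations are `ι_w ≫ f →_g f` for
`w →_g ε` in `B_ε`, where the words `w` and `ε` stand for the cubes `ι_w(min(B_{p(w)}))` and
`min(B_ε)`. -/
def blowup (n : ℕ) (P : RelPrecubicalSet.{w}) : RelPrecubicalSet.{w} where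
  obj k := {x : Σ ε : List Bool, (brick.{w} ε ⟶ P) // x.1.length = n ∧ brickDim x.1 = k}
  rel {_ _} g x y := ∃ (v : BrickWord x.1.1 y.1.1) (g' : brickDim y.1.1 ⟶ brickDim x.1.1),
    g'.word = g.word ∧
    (brick.{w} y.1.1).rel g' (v.incl.app _ (brickMin x.1.1)) (brickMin y.1.1) ∧
    x.1.2 = v.incl ≫ y.1.2
  rel_id {c} x := ⟨BrickWord.id _, 𝟙 _, by rw [CubeCat.id_word, CubeCat.id_word, x.2.2],
    by rw [BrickWord.incl_id]; exact (brick _).rel_id _, by rw [BrickWord.incl_id]; simp⟩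
  rel_comp := by
    rintro c d e f f' x y z ⟨v, g, e1, h1, h2⟩ ⟨v', g', e2, h3, h4⟩
    refine ⟨v.comp v', g' ≫ g, by rw [CubeCat.comp_word, CubeCat.comp_word, e1, e2], ?_, ?_⟩
    · rw [BrickWord.incl_comp]
      exact (brick _).rel_comp (v'.incl.map_rel h1) h3
    · rw [BrickWord.incl_comp, Category.assoc, ← h4, h2]

/-- The blowup map `β_P : f ↦ f(min(dom f))`. -/
def blowupMap (n : ℕ) (P : RelPrecubicalSet.{w}) : blowup n P ⟶ P :=
  Hom.mk (fun k x => x.2.2 ▸ x.1.2.app _ (brickMin x.1.1)) (by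
    rintro c d f ⟨⟨ε, x⟩, _, rfl⟩ ⟨⟨ε', y⟩, _, rfl⟩ ⟨v, g, e, h, h'⟩
    obtain rfl : g = f := CubeCat.hom_ext e
    exact (congrArg (fun α : brick ε ⟶ P =>
      P.rel g (α.app _ (brickMin ε)) (y.app _ (brickMin ε'))) h').mpr (y.map_rel h))

end RelPrecubicalSet

/-! The cells of `B_ε` are words, and the cells above a word `w` are those of the smaller brick
`B_{p(w)}` (`exists_cell_eq`, `exists_comp_of_cell_rel`, `cellIndex_cell`). A word is determined by
its source and its face, which forces a morphism from `B_ε` to a blowup to send the minimal cube to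
a morphism whose domain is again `B_ε`. Hence morphisms from `B_ε` to the blowup of `P` correspond
through `β_P` to morphisms from `B_ε` to `P` (`eq_classify`), and `β_P` has the right lifting
property (`blowupMap_mem_rlp`).

The codiagonals turn existence of lifts into unique existence (`mem_rlp_iff`). Since a punctured
brick is glued from bricks with fewer letters 1, bricks lift uniquely through every morphism with
the right lifting property (`liftsUniquely_brick`); two-out-of-three follows. A section of `β_P`
covers `P` compatibly by bricks, so unique lifting passes to `P` (`liftsUniquely_of_section`).
Therefore `P` is cofibrant iff `β_P` has a section, and cofibrant replacements are unique.

If `P` is euclidean, counting cells shows that charts restrict to charts, and rigidity of bricks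
makes the chart at each cube unique; the charts then form a section of `β_P`
(`IsEuclidean.exists_section`). Conversely, a section makes `P` isomorphic to its blowup, which is
euclidean.

Factorizations are built without a transfinite construction, as the initial one among those whose
second morphism has the right lifting property (`exists_factorization`). The other weak
factorization system is (isomorphisms, all morphisms). -/

theorem RelPresheaf.rel_eqToHom {C : Type u} [Category.{v} C] (P : RelPresheaf.{w} C) {c d : C}
    {x : P.obj c} {y : P.obj d} (e : c = d) (h : e ▸ x = y) : P.rel (eqToHom e.symm) x y := by
  subst e h
  exact P.rel_id x

/-! ### Words and the cells of a brick. -/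

namespace RelPrecubicalSet
open RelPresheaf
namespace BrickWord

/-- Every cell of a closed brick above its center is the center of a smaller brick. -/
theorem exists_closedMap_center {ε : List Bool} {k : CubeCat} (y : (closedBrick.{w} ε).obj k)
    (f : brickDim ε ⟶ k) (h : (closedBrick ε).rel f y (center ε)) :
    ∃ (ε' : List Bool) (v : BrickWord ε' ε) (_ : brickDim ε' = k),
      HEq (v.closedMap.app _ (center ε')) y ∧ v.faceWord = f.word := by
  induction ε generalizing k with
  | nil =>
    have e : brickDim [] = k := CubeCat.ext y.2.symm
    refine ⟨[], nil, e, ?_, ?_⟩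
    · subst e; rfl
    · subst e; exact (List.length_eq_zero_iff.1 f.length_eq).symm
  | cons b ε ih =>
    obtain ⟨⟨⟨i, a⟩, ⟨j, y⟩⟩, hk⟩ := y
    obtain ⟨g, h', e, h1, h2⟩ := h
    obtain ⟨ε', v, rfl, h3, h4⟩ := ih y h' h2
    obtain rfl := eq_of_heq h3
    rw [e, ← h4]
    cases b
    · cases a with
      | vertex i => exact h1.elim
      | edge i =>
        have e : brickDim (false :: ε') = k := CubeCat.ext (by
          simpa [brickDim, Nat.add_comm] using hk)
        subst e
        refine ⟨_, zero v, rfl, ?_, ?_⟩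
        · obtain rfl := Subsingleton.elim i 0
          rfl
        · rw [CubeCat.hom_self_eq_id g]; rfl
    · cases a with
      | vertex i =>
        have e : brickDim (true :: ε') = k := CubeCat.ext (by
          simpa [brickDim, Nat.add_comm] using hk)
        subst e
        obtain rfl : i = 1 := h1
        refine ⟨_, one v, rfl, ?_, ?_⟩
        · rfl
        · rw [CubeCat.hom_self_eq_id g]; rfl
      | edge i =>
        have e : brickDim (false :: ε') = k := CubeCat.ext (by
          simpa [brickDim, Nat.add_comm] using hk)
        subst e
        -- Signs are reversed: the first edge of `V_1` has the central vertex as its target, hence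
        -- as its `+` face, and the second edge has it as its `-` face.
        have key : g.word = [some (!(i = (1 : Fin 2) : Bool))] := by
          rcases h1 with ⟨h, h'⟩ | ⟨h, h'⟩ <;> rw [h] <;> revert h' <;> fin_cases i <;> simp
        refine ⟨_, sign (i = (1 : Fin 2) : Bool) v, rfl, ?_, ?_⟩
        · fin_cases i <;> rfl
        · rw [key]; rfl

/-- A relation in a tensor product splits into one relation per direction, so the word `u` is found
letter by letter. The letter `1` cannot lie above a sign, since a vertex has no edge as a face. -/
theorem exists_comp_of_rel {ε₁ ε₂ ε : List Bool} (v : BrickWord ε₁ ε) (v' : BrickWord ε₂ ε)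
    (g : brickDim ε₂ ⟶ brickDim ε₁)
    (h : (closedBrick.{w} ε).rel g (v.closedMap.app _ (center ε₁)) (v'.closedMap.app _ (center ε₂))) :
    ∃ u : BrickWord ε₁ ε₂, u.comp v' = v ∧ u.faceWord = g.word := by
  induction v generalizing ε₂ with
  | nil =>
    cases v'
    exact ⟨nil, rfl, (List.length_eq_zero_iff.1 g.length_eq).symm⟩
  | zero v ih =>
    cases v' with
    | zero v' =>
      obtain ⟨g₁, g₂, e, h1, h2⟩ := h
      obtain ⟨u, rfl, hu⟩ := ih v' g₂ h2
      refine ⟨zero u, rfl, ?_⟩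
      rw [e, CubeCat.hom_self_eq_id g₁, ← hu]; rfl
  | one v ih =>
    cases v' with
    | one v' =>
      obtain ⟨g₁, g₂, e, h1, h2⟩ := h
      obtain ⟨u, rfl, hu⟩ := ih v' g₂ h2
      refine ⟨one u, rfl, ?_⟩
      rw [e, CubeCat.hom_self_eq_id g₁, ← hu]; rfl
    | sign s v' =>
      obtain ⟨g₁, g₂, e, h1, h2⟩ := h
      exact h1.elim
  | sign s v ih =>
    cases v' with
    | one v' =>
      obtain ⟨g₁, g₂, e, h1, h2⟩ := h
      obtain ⟨u, rfl, hu⟩ := ih v' g₂ h2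
      refine ⟨sign s u, rfl, ?_⟩
      rw [e, ← hu]
      have : g₁.word = [some (!s)] := by
        rcases h1 with ⟨h, h'⟩ | ⟨h, h'⟩
        · cases s
          · exact absurd h' (by decide)
          · exact h
        · cases s
          · exact h
          · exact absurd h' (by decide)
      rw [this]; rfl
    | sign s' v' =>
      obtain ⟨g₁, g₂, e, h1, h2⟩ := h
      obtain ⟨u, rfl, hu⟩ := ih v' g₂ h2
      have hs : s = s' := by
        have h1 : (bif s then (0 : Fin 1).succ else (0 : Fin 1).castSucc) =
          bif s' then (0 : Fin 1).succ else (0 : Fin 1).castSucc := h1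
        cases s <;> cases s' <;> first | rfl | exact absurd h1 (by decide)
      subst hs
      refine ⟨zero u, rfl, ?_⟩
      rw [e, CubeCat.hom_self_eq_id g₁, ← hu]; rfl

theorem length_eq {ε' ε : List Bool} (v : BrickWord ε' ε) : ε'.length = ε.length := by
  induction v <;> simp_all

theorem count_true_le {ε' ε : List Bool} (v : BrickWord ε' ε) :
    ε'.count true ≤ ε.count true := by
  induction v <;> simp_all; omega

/-- A word with the same number of letters `1` on both sides is maximal. -/
theorem eq_id_of_count_le {ε' ε : List Bool} (v : BrickWord ε' ε)
    (h : ε.count true ≤ ε'.count true) :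
    (⟨ε', v⟩ : Σ ε', BrickWord ε' ε) = ⟨ε, BrickWord.id ε⟩ := by
  induction v with
  | nil => rfl
  | zero v ih =>
    obtain ⟨rfl, h⟩ := Sigma.mk.inj_iff.1 (ih (by simpa using h))
    rw [eq_of_heq h]; rfl
  | one v ih =>
    obtain ⟨rfl, h⟩ := Sigma.mk.inj_iff.1 (ih (by simpa using h))
    rw [eq_of_heq h]; rfl
  | sign s v ih =>
    have := v.count_true_le
    simp at h; omega

/-- A word is determined by its source and its face. -/
theorem eq_of_faceWord_eq {ε' ε₁ ε₂ : List Bool} (v₁ : BrickWord ε' ε₁) (v₂ : BrickWord ε' ε₂)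
    (h : v₁.faceWord = v₂.faceWord) :
    (⟨ε₁, v₁⟩ : Σ ε, BrickWord ε' ε) = ⟨ε₂, v₂⟩ := by
  induction v₁ generalizing ε₂ with
  | nil => cases v₂; rfl
  | zero v ih =>
    cases v₂ with
    | zero v' =>
      obtain ⟨rfl, h⟩ := Sigma.mk.inj_iff.1 (ih v' (by simpa [faceWord] using h))
      rw [eq_of_heq h]
    | sign s v' => simp [faceWord] at h
  | one v ih =>
    cases v₂ with
    | one v' =>
      obtain ⟨rfl, h⟩ := Sigma.mk.inj_iff.1 (ih v' (by simpa [faceWord] using h))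
      rw [eq_of_heq h]
  | sign s v ih =>
    cases v₂ with
    | zero v' => simp [faceWord] at h
    | sign s' v' =>
      simp [faceWord] at h
      obtain ⟨rfl, h'⟩ := h
      obtain ⟨rfl, h⟩ := Sigma.mk.inj_iff.1 (ih v' h')
      rw [eq_of_heq h]

/-- A word without letters `1`, corresponding to a top-dimensional cell. -/
def top : ∀ ε : List Bool, BrickWord (List.replicate ε.length false) ε
  | [] => nil
  | false :: ε => zero (top ε)
  | true :: ε => sign true (top ε)

/-- The cell of a brick given by a word. -/
def cell {ε' ε : List Bool} (v : BrickWord ε' ε) : (brick.{w} ε).obj (brickDim ε') :=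
  v.incl.app _ (brickMin ε')

theorem cell_val_snd {ε' ε : List Bool} (v : BrickWord ε' ε) : v.cell.{w}.1.2 = v.face :=
  Category.comp_id _

theorem cell_id (ε : List Bool) : (BrickWord.id ε).cell = brickMin.{w} ε := by
  rw [cell, incl_id]; rfl

theorem incl_cell {ε'' ε' ε : List Bool} (v : BrickWord ε'' ε') (v' : BrickWord ε' ε) :
    v'.incl.app _ v.cell.{w} = (v.comp v').cell := by
  rw [cell, cell, incl_comp]; rfl

theorem rel_cell {ε' ε : List Bool} (v : BrickWord ε' ε) :
    (brick.{w} ε).rel v.face v.cell (brickMin ε) :=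
  ⟨(v.cell_val_snd.{w}).trans (Category.id_comp _).symm, v.closedMap_center⟩

theorem exists_cell_eq {ε : List Bool} {k : CubeCat} (x : (brick.{w} ε).obj k) :
    ∃ (ε' : List Bool) (v : BrickWord ε' ε) (h : brickDim ε' = k), h ▸ v.cell = x := by
  obtain ⟨⟨y, f⟩, h⟩ := x
  obtain ⟨ε', v, rfl, h1, h2⟩ := exists_closedMap_center y f h
  refine ⟨ε', v, rfl, Subtype.ext (Prod.ext (eq_of_heq h1) ?_)⟩
  exact v.cell_val_snd.{w}.trans (CubeCat.hom_ext h2)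

theorem exists_comp_of_cell_rel {ε₁ ε₂ ε : List Bool} (v : BrickWord ε₁ ε) (v' : BrickWord ε₂ ε)
    (g : brickDim ε₂ ⟶ brickDim ε₁) (h : (brick.{w} ε).rel g v.cell v'.cell) :
    ∃ u : BrickWord ε₁ ε₂, u.comp v' = v ∧ u.face = g := by
  obtain ⟨u, h1, h2⟩ := exists_comp_of_rel v v' g h.2
  exact ⟨u, h1, CubeCat.hom_ext h2⟩

protected theorem id_comp {ε' ε : List Bool} (v : BrickWord ε' ε) :
    (BrickWord.id ε').comp v = v := by
  induction v <;> simp_all [comp, BrickWord.id]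

theorem count_true_eq {ε' ε : List Bool} (h : brickDim ε' = brickDim ε)
    (h' : ε'.length = ε.length) : ε'.count true = ε.count true := by
  have h1 := List.count_false_add_count_true ε'
  have h2 := List.count_false_add_count_true ε
  have h3 : ε'.count false = ε.count false := congrArg CubeCat.dim h
  omega

end BrickWord

open BrickWord

/-- The word of a cell of a brick. -/
noncomputable def cellIndex {ε : List Bool} {k : CubeCat} (x : (brick.{w} ε).obj k) :
    Σ ε', BrickWord ε' ε :=
  ⟨_, (exists_cell_eq x).choose_spec.choose⟩

theorem brickDim_cellIndex {ε : List Bool} {k : CubeCat} (x : (brick.{w} ε).obj k) :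
    brickDim (cellIndex x).1 = k := (exists_cell_eq x).choose_spec.choose_spec.choose

theorem cell_cellIndex {ε : List Bool} {k : CubeCat} (x : (brick.{w} ε).obj k) :
    brickDim_cellIndex x ▸ (cellIndex x).2.cell = x :=
  (exists_cell_eq x).choose_spec.choose_spec.choose_spec

/-- To prove a property of cells of a brick, it is enough to consider those given by words. -/
theorem brick_cases {ε : List Bool} {motive : ∀ k, (brick.{w} ε).obj k → Prop}
    (h : ∀ (ε' : List Bool) (v : BrickWord ε' ε), motive _ v.cell) {k : CubeCat}
    (x : (brick.{w} ε).obj k) : motive k x := by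
  obtain ⟨ε', v, rfl, rfl⟩ := exists_cell_eq x
  exact h ε' v

theorem exists_comp_cellIndex {ε : List Bool} {k l : CubeCat} {x : (brick.{w} ε).obj k}
    {y : (brick.{w} ε).obj l} {g : l ⟶ k} (h : (brick.{w} ε).rel g x y) :
    ∃ u : BrickWord (cellIndex x).1 (cellIndex y).1,
      u.comp (cellIndex y).2 = (cellIndex x).2 ∧ u.faceWord = g.word := by
  have hx := cell_cellIndex x
  have hy := cell_cellIndex y
  generalize brickDim_cellIndex x = ex at hx
  generalize brickDim_cellIndex y = ey at hy
  generalize cellIndex x = i at *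
  generalize cellIndex y = j at *
  subst ex ey hx hy
  obtain ⟨u, h1, rfl⟩ := exists_comp_of_cell_rel _ _ _ h
  exact ⟨u, h1, rfl⟩

/-- Distinct words give distinct cells: the word chosen for `v.cell` is `u.comp v` for some `u`, and
equality of dimensions leaves no sign in `u`, which is thus an identity. -/
theorem cellIndex_cell {ε' ε : List Bool} (v : BrickWord ε' ε) : cellIndex v.cell.{w} = ⟨ε', v⟩ := by
  have ex := brickDim_cellIndex.{w} v.cell
  obtain ⟨u, h1, -⟩ := exists_comp_of_cell_rel _ _ _
    ((brick ε).rel_eqToHom (brickDim_cellIndex.{w} v.cell) (cell_cellIndex.{w} v.cell))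
  generalize cellIndex.{w} v.cell = i at *
  obtain ⟨ε'', v'⟩ := i
  obtain ⟨rfl, h'⟩ := Sigma.mk.inj_iff.1
    (u.eq_id_of_count_le (BrickWord.count_true_eq ex u.length_eq).ge)
  obtain rfl := eq_of_heq h'
  rw [BrickWord.id_comp] at h1
  rw [h1]

theorem cellIndex_brickMin (ε : List Bool) :
    cellIndex (brickMin.{w} ε) = ⟨ε, BrickWord.id ε⟩ := by
  rw [← cell_id, cellIndex_cell]

theorem brick_hom_ext {ε : List Bool} {P : RelPrecubicalSet.{w}} {f g : brick ε ⟶ P}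
    (h : ∀ (ε' : List Bool) (v : BrickWord ε' ε), f.app _ v.cell = g.app _ v.cell) : f = g := by
  ext k x
  exact brick_cases (motive := fun k x => f.app k x = g.app k x) h x

end RelPrecubicalSet

/-! ### Morphisms from bricks to blowups. -/

namespace RelPrecubicalSet
open RelPresheaf BrickWord

variable {n : ℕ} {P Q : RelPrecubicalSet.{w}}

/-- The cells of an upward neighborhood record their morphism to the base cube, so the `g'` in the
definition can only be `v.face`. -/
theorem blowup_rel_iff {k l : CubeCat} {g : l ⟶ k} {x : (blowup n P).obj k}
    {y : (blowup n P).obj l} : (blowup n P).rel g x y ↔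
      ∃ v : BrickWord x.1.1 y.1.1, v.faceWord = g.word ∧ x.1.2 = v.incl ≫ y.1.2 := by
  constructor
  · rintro ⟨v, g', h, h1, h2⟩
    have h3 : v.face = g' := v.cell_val_snd.{w}.symm.trans (h1.1.trans (Category.id_comp _))
    exact ⟨v, by rw [← h, ← h3]; rfl, h2⟩
  · rintro ⟨v, h, h2⟩
    exact ⟨v, v.face, h, v.rel_cell, h2⟩

/-- The functoriality of the blowup. -/
def blowupFunctorMap (n : ℕ) (p : P ⟶ Q) : blowup n P ⟶ blowup n Q :=
  Hom.mk (fun _ x => ⟨⟨x.1.1, x.1.2 ≫ p⟩, x.2⟩) (by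
    intro k l g x y h
    obtain ⟨v, h1, h2⟩ := blowup_rel_iff.1 h
    exact blowup_rel_iff.2 ⟨v, h1, by rw [h2, Category.assoc]⟩)

theorem blowupFunctorMap_comp_blowupMap (p : P ⟶ Q) :
    blowupFunctorMap n p ≫ blowupMap n Q = blowupMap n P ≫ p := by
  ext k ⟨⟨ε, f⟩, h, rfl⟩
  rfl

/-- The morphism to the blowup corresponding to a morphism from a brick. -/
noncomputable def classify {ε : List Bool} (hε : ε.length = n) (f : brick ε ⟶ P) :
    brick ε ⟶ blowup n P :=
  Hom.mk (fun _ x => ⟨⟨(cellIndex x).1, (cellIndex x).2.incl ≫ f⟩,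
    (cellIndex x).2.length_eq.trans hε, brickDim_cellIndex x⟩) (by
    intro k l g x y h
    obtain ⟨u, h1, h2⟩ := exists_comp_cellIndex h
    exact blowup_rel_iff.2 ⟨u, h2, by rw [← h1, incl_comp, Category.assoc]⟩)

theorem classify_cell {ε' ε : List Bool} (hε : ε.length = n) (f : brick ε ⟶ P)
    (v : BrickWord ε' ε) :
    (classify hε f).app _ v.cell = ⟨⟨ε', v.incl ≫ f⟩, v.length_eq.trans hε, rfl⟩ := by
  apply Subtype.ext
  exact congrArg (fun i : Σ ε', BrickWord ε' ε => (⟨i.1, i.2.incl ≫ f⟩ : Σ ε, (brick ε ⟶ P)))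
    (cellIndex_cell v)

theorem classify_brickMin {ε : List Bool} (hε : ε.length = n) (f : brick ε ⟶ P) :
    (classify hε f).app _ (brickMin ε) = ⟨⟨ε, f⟩, hε, rfl⟩ := by
  rw [← cell_id, classify_cell]
  congr 2
  rw [incl_id, Category.id_comp]

theorem classify_comp_blowupMap {ε : List Bool} (hε : ε.length = n) (f : brick ε ⟶ P) :
    classify hε f ≫ blowupMap n P = f := by
  refine brick_hom_ext fun ε' v => ?_
  exact congrArg ((blowupMap n P).app _) (classify_cell hε f v)

theorem incl_comp_classify {ε' ε : List Bool} (hε : ε.length = n) (f : brick ε ⟶ P)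
    (v : BrickWord ε' ε) :
    v.incl ≫ classify hε f = classify (v.length_eq.trans hε) (v.incl ≫ f) := by
  refine brick_hom_ext fun ε'' v' => ?_
  rw [comp_app, incl_cell, classify_cell, classify_cell, incl_comp, Category.assoc]

theorem eq_replicate_of_brickDim {ε : List Bool} (hε : ε.length = n)
    (h : brickDim ε = brickDim (List.replicate n false)) : ε = List.replicate n false := by
  rw [List.eq_replicate_iff]
  have h : ε.count false = n := by simpa [brickDim] using congrArg CubeCat.dim h
  exact ⟨hε, fun b hb => (List.count_eq_length.1 (h.trans hε.symm) b hb).symm⟩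

/-- A top cell goes to an `n`-cube of the blowup, whose domain can only be the brick without letters
1. Its relation to the minimal cube becomes a word with the same source and face as `top ε`, hence
with the same target. -/
theorem source_app_brickMin {ε : List Bool} (hε : ε.length = n) (φ : brick ε ⟶ blowup n P) :
    (φ.app _ (brickMin ε)).1.1 = ε := by
  obtain ⟨u, h1, -⟩ := blowup_rel_iff.1 (φ.map_rel (top ε).rel_cell)
  have ht := (φ.app _ (top ε).cell).2
  generalize φ.app _ (top ε).cell = t at *
  generalize φ.app _ (brickMin ε) = z at *
  obtain ⟨⟨ε₁, f⟩, ht⟩ := t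
  subst hε
  obtain rfl := eq_replicate_of_brickDim ht.1 ht.2
  exact congrArg Sigma.fst (eq_of_faceWord_eq u (top ε) h1)

/-- A morphism from a brick to a blowup is determined by its composition with the blowup map. -/
theorem eq_classify {ε : List Bool} (hε : ε.length = n) (φ : brick ε ⟶ blowup n P) :
    φ = classify hε (φ ≫ blowupMap n P) := by
  suffices ∃ f, φ = classify hε f by
    obtain ⟨f, h⟩ := this
    rw [h, classify_comp_blowupMap]
  obtain ⟨f, hf⟩ : ∃ f, φ.app _ (brickMin ε) = ⟨⟨ε, f⟩, hε, rfl⟩ := by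
    have h := source_app_brickMin hε φ
    generalize φ.app _ (brickMin ε) = z at *
    obtain ⟨⟨ε₁, f⟩, hz⟩ := z
    obtain rfl : ε₁ = ε := h
    exact ⟨f, rfl⟩
  refine ⟨f, brick_hom_ext fun ε' v => ?_⟩
  have h := φ.map_rel v.rel_cell
  rw [hf] at h
  obtain ⟨u, h1, h2⟩ := blowup_rel_iff.1 h
  -- Restricting `φ` along `v.incl` makes an arbitrary cell minimal, so the preceding lemma gives
  -- the domain of its image too.
  have h3 := source_app_brickMin (v.length_eq.trans hε) (v.incl ≫ φ)
  rw [classify_cell]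
  change (φ.app _ v.cell).1.1 = ε' at h3
  generalize φ.app _ v.cell = z at *
  obtain ⟨⟨ε₁, f'⟩, hz⟩ := z
  obtain rfl : ε₁ = ε' := h3
  obtain rfl := eq_of_heq (Sigma.mk.inj_iff.1 (eq_of_faceWord_eq u v h1)).2
  exact Subtype.ext (congrArg (Sigma.mk ε₁) h2)

/-- The canonical section of the blowup map of a blowup. -/
noncomputable def blowupSection (n : ℕ) (P : RelPrecubicalSet.{w}) :
    blowup n P ⟶ blowup n (blowup n P) :=
  Hom.mk (fun _ x => ⟨⟨x.1.1, classify x.2.1 x.1.2⟩, x.2⟩) (by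
    intro k l g x y h
    obtain ⟨v, h1, h2⟩ := blowup_rel_iff.1 h
    refine blowup_rel_iff.2 ⟨v, h1, ?_⟩
    simp only [incl_comp_classify, h2])

theorem blowupSection_comp_blowupMap : blowupSection n P ≫ blowupMap n (blowup n P) = 𝟙 _ := by
  ext k ⟨⟨ε, f⟩, h, rfl⟩
  exact classify_brickMin h f

/-! ## Lifting properties -/

/-- Every morphism from `P` to the target of `p` lifts uniquely to the source of `p`. -/
def LiftsUniquely (P : RelPrecubicalSet.{w}) {E F : RelPrecubicalSet.{w}} (p : E ⟶ F) : Prop :=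
  ∀ g : P ⟶ F, ∃! h : P ⟶ E, h ≫ p = g

theorem LiftsUniquely.hom_ext {E F : RelPrecubicalSet.{w}} {p : E ⟶ F} (hP : LiftsUniquely P p)
    {h h' : P ⟶ E} (e : h ≫ p = h' ≫ p) : h = h' :=
  (hP (h' ≫ p)).unique e rfl

/-- The lifts over the bricks chosen by `s` are cubes of the blowup of `E`, and their uniqueness
makes them compatible with the relations; composing with `β_E` gives the lift. Only the bricks
occurring in `s` are required to lift, which permits induction on bricks. -/
theorem liftsUniquely_of_section {E F : RelPrecubicalSet.{w}} (p : E ⟶ F) (s : P ⟶ blowup n P)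
    (hs : s ≫ blowupMap n P = 𝟙 P)
    (hp : ∀ k (c : P.obj k), LiftsUniquely (brick (s.app k c).1.1) p) : LiftsUniquely P p := by
  intro g
  choose L hL hL' using fun k c => hp k c ((s.app k c).1.2 ≫ g)
  let t : P ⟶ blowup n E := Hom.mk (fun k c => ⟨⟨(s.app k c).1.1, L k c⟩, (s.app k c).2⟩) (by
    intro k l f d c h
    obtain ⟨v, h1, h2⟩ := blowup_rel_iff.1 (s.map_rel h)
    refine blowup_rel_iff.2 ⟨v, h1, (hp k d).hom_ext ?_⟩
    simp only [Category.assoc, hL, h2])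
  have ht : t ≫ blowupFunctorMap n p = s ≫ blowupFunctorMap n g := by
    ext k c
    exact Subtype.ext (congrArg (Sigma.mk _) (hL k c))
  refine ⟨t ≫ blowupMap n E, ?_, fun h hh => ?_⟩
  · simp only [Category.assoc]
    rw [← blowupFunctorMap_comp_blowupMap, ← Category.assoc, ht, Category.assoc,
      blowupFunctorMap_comp_blowupMap, ← Category.assoc, hs, Category.id_comp]
  · rw [← Category.id_comp h, ← hs, Category.assoc, ← blowupFunctorMap_comp_blowupMap,
      ← Category.assoc]
    congr 1
    ext k c
    refine Subtype.ext (congrArg (Sigma.mk _) (hL' k c _ ?_))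
    change ((s.app k c).1.2 ≫ h) ≫ p = _
    rw [Category.assoc, hh]

/-- Lifting a morphism through the inclusion of a relational subpresheaf. -/
def restrictLift {R : RelPrecubicalSet.{w}} (S : ∀ k, Set (P.obj k)) (f : R ⟶ P)
    (h : ∀ k x, f.app k x ∈ S k) : R ⟶ P.restrict S :=
  Hom.mk (fun k x => ⟨f.app k x, h k x⟩) (fun r => f.map_rel r)

/-- A section of the blowup map restricts to upward closed subpresheaves. -/
theorem exists_section_restrict (S : ∀ k, Set (P.obj k))
    (hS : ∀ {k l : CubeCat} {f : l ⟶ k} {x y}, P.rel f x y → y ∈ S l → x ∈ S k)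
    (s : P ⟶ blowup n P) (hs : s ≫ blowupMap n P = 𝟙 P) :
    ∃ s' : P.restrict S ⟶ blowup n (P.restrict S), s' ≫ blowupMap n _ = 𝟙 _ ∧
      ∀ k c, (s'.app k c).1.1 = (s.app k c.1).1.1 := by
  have hs' (k) (c : P.obj k) : (blowupMap n P).app k (s.app k c) = c :=
    congrArg (fun φ : P ⟶ P => φ.app k c) hs
  -- The minimal cube of the chosen brick goes to `c`, and all its other cells lie above it, so the
  -- whole brick lands in the upward closed `S`.
  have H (k) (c : P.obj k) (hc : c ∈ S k) (l) (x : (brick (s.app k c).1.1).obj l) :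
      (s.app k c).1.2.app l x ∈ S l := by
    have hc' : (s.app k c).1.2.app _ (brickMin _) ∈ S _ := by
      have := hs' k c
      generalize s.app k c = z at *
      obtain ⟨⟨ε, f⟩, h, rfl⟩ := z
      exact Set.mem_of_eq_of_mem this hc
    refine brick_cases (motive := fun l x => (s.app k c).1.2.app l x ∈ S l) (fun ε' v => ?_) x
    exact hS ((s.app k c).1.2.map_rel v.rel_cell) hc'
  refine ⟨Hom.mk (fun k c => ⟨⟨_, restrictLift S (s.app k c.1).1.2 (H k c.1 c.2)⟩,
    (s.app k c.1).2⟩) ?_, ?_, fun _ _ => rfl⟩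
  · intro k l g x y h
    obtain ⟨v, h1, h2⟩ := blowup_rel_iff.1 (s.map_rel (show P.rel g x.1 y.1 from h))
    refine blowup_rel_iff.2 ⟨v, h1, ?_⟩
    ext m z
    exact Subtype.ext (congrArg (fun φ : brick _ ⟶ P => φ.app m z) h2)
  · ext k ⟨c, hc⟩
    apply Subtype.ext
    have := hs' k c
    have H' := H k c hc
    change ((s.app k c).2.2 ▸ (restrictLift S (s.app k c).1.2 H').app _ (brickMin _) :
      (P.restrict S).obj k).1 = c
    generalize s.app k c = z at *
    obtain ⟨⟨ε, f⟩, h, rfl⟩ := z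
    exact this

/-- Punctured bricks are upward closed: a relation from the minimal cube to `y` would give a word
from `ε` to the source of `y`, which then has as many letters 1 as `ε`, so that `y` is minimal. -/
theorem not_rel_brickMin_of_ne {ε : List Bool} {k l : CubeCat} {f : l ⟶ k}
    {x : (brick.{w} ε).obj k} {y : (brick.{w} ε).obj l} (h : (brick.{w} ε).rel f x y)
    (hy : (⟨l, y⟩ : Σ k, (brick.{w} ε).obj k) ≠ ⟨_, brickMin ε⟩) :
    (⟨k, x⟩ : Σ k, (brick.{w} ε).obj k) ≠ ⟨_, brickMin ε⟩ := by
  intro hx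
  obtain ⟨rfl, hx⟩ := Sigma.mk.inj_iff.1 hx
  obtain rfl := eq_of_heq hx
  apply hy
  obtain ⟨ε', v, rfl, rfl⟩ := exists_cell_eq y
  rw [← cell_id] at h
  obtain ⟨u, -, -⟩ := exists_comp_of_cell_rel _ _ _ h
  obtain ⟨rfl, hv⟩ := Sigma.mk.inj_iff.1 (v.eq_id_of_count_le u.count_true_le)
  obtain rfl := eq_of_heq hv
  rw [cell_id]

theorem count_true_cellIndex_lt {ε : List Bool} {k : CubeCat} {x : (brick.{w} ε).obj k}
    (hx : (⟨k, x⟩ : Σ k, (brick.{w} ε).obj k) ≠ ⟨_, brickMin ε⟩) :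
    (cellIndex x).1.count true < ε.count true := by
  by_contra! h
  apply hx
  have h1 := (cellIndex x).2.eq_id_of_count_le h
  have h2 := cell_cellIndex x
  generalize brickDim_cellIndex x = e at *
  generalize cellIndex x = i at *
  obtain rfl : i = _ := h1
  obtain rfl : _ = k := e
  obtain rfl : _ = x := h2
  rw [cell_id]

/-- Two lifts of one square glue to a morphism from the pushout, and a lift against the codiagonal
says exactly that they agree. -/
theorem mem_rlp_iff {E F : RelPrecubicalSet.{w}} (p : E ⟶ F) :
    (generatingCofibrations.{w} n).rlp p ↔ ∀ ε : List Bool, ε.length = n →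
      ∀ (a : puncturedBrick ε ⟶ E) (b : brick ε ⟶ F), a ≫ p = brickIncl ε ≫ b →
        ∃! l : brick ε ⟶ E, brickIncl ε ≫ l = a ∧ l ≫ p = b := by
  constructor
  · intro hp ε hε a b h
    have h1 : HasLiftingProperty (brickIncl ε) p := hp _ (.incl ε hε)
    have h2 : HasLiftingProperty (pushout.codiagonal (brickIncl ε)) p := hp _ (.codiagonal ε hε)
    have sq : CommSq a (brickIncl ε) p b := ⟨h⟩
    refine ⟨sq.lift, ⟨sq.fac_left, sq.fac_right⟩, fun l hl => ?_⟩
    have sq' : CommSq (pushout.desc l sq.lift (hl.1.trans sq.fac_left.symm))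
        (pushout.codiagonal (brickIncl ε)) p b :=
      ⟨pushout.hom_ext
        (by rw [pushout.inl_desc_assoc, pushout.inl_codiagonal_assoc, hl.2])
        (by rw [pushout.inr_desc_assoc, pushout.inr_codiagonal_assoc, sq.fac_right])⟩
    have e1 := congrArg (pushout.inl _ _ ≫ ·) sq'.fac_left
    have e2 := congrArg (pushout.inr _ _ ≫ ·) sq'.fac_left
    simp only [pushout.inl_codiagonal_assoc, pushout.inr_codiagonal_assoc, pushout.inl_desc,
      pushout.inr_desc] at e1 e2
    rw [← e1, e2]
  · rintro H _ _ _ (⟨ε, hε⟩ | ⟨ε, hε⟩)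
    · exact ⟨fun {a b} sq => by
        obtain ⟨l, ⟨h1, h2⟩, -⟩ := H ε hε a b sq.w
        exact ⟨⟨⟨l, h1, h2⟩⟩⟩⟩
    · refine ⟨fun {a b} sq => ?_⟩
      have e1 : (pushout.inl _ _ ≫ a) ≫ p = b := by
        rw [Category.assoc, sq.w, pushout.inl_codiagonal_assoc]
      have e2 : (pushout.inr _ _ ≫ a) ≫ p = b := by
        rw [Category.assoc, sq.w, pushout.inr_codiagonal_assoc]
      have e3 : pushout.inl _ _ ≫ a = pushout.inr _ _ ≫ a :=
        (H ε hε (brickIncl ε ≫ pushout.inl _ _ ≫ a) b (by rw [Category.assoc, e1])).unique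
          ⟨rfl, e1⟩ ⟨by rw [← Category.assoc, ← Category.assoc, pushout.condition], e2⟩
      exact ⟨⟨⟨pushout.inl _ _ ≫ a, pushout.hom_ext (by rw [pushout.inl_codiagonal_assoc])
        (by rw [pushout.inr_codiagonal_assoc, e3]), e1⟩⟩⟩

/-- The canonical section for `B_ε` restricts to the punctured brick, where it involves only bricks
with fewer letters 1. -/
theorem liftsUniquely_puncturedBrick_aux {E F : RelPrecubicalSet.{w}} {p : E ⟶ F} {ε : List Bool}
    (hε : ε.length = n) (H : ∀ ε' : List Bool, ε'.length = n → ε'.count true < ε.count true →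
      LiftsUniquely (brick ε') p) : LiftsUniquely (puncturedBrick ε) p := by
  obtain ⟨s, hs, hs'⟩ := exists_section_restrict
    (fun k => {x | (⟨k, x⟩ : Σ k, (brick.{w} ε).obj k) ≠ ⟨_, brickMin ε⟩})
    (fun h hy => not_rel_brickMin_of_ne h hy) (classify hε (𝟙 (brick.{w} ε)))
    (classify_comp_blowupMap _ _)
  exact liftsUniquely_of_section p s hs fun k c => H _ (s.app k c).2.1
    ((congrArg (List.count true) (hs' k c)).trans_lt (count_true_cellIndex_lt c.2))

/-- By induction on the number of letters 1, the punctured brick lifts uniquely; orthogonality then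
extends the lift over the minimal cube. -/
theorem liftsUniquely_brick {E F : RelPrecubicalSet.{w}} {p : E ⟶ F}
    (hp : (generatingCofibrations.{w} n).rlp p) {ε : List Bool} (hε : ε.length = n) :
    LiftsUniquely (brick ε) p := by
  induction hc : ε.count true using Nat.strong_induction_on generalizing ε with
  | _ m ih =>
    subst hc
    have hA := liftsUniquely_puncturedBrick_aux hε fun ε' h h' => ih _ h' h rfl
    intro g
    obtain ⟨a, ha, -⟩ := hA (brickIncl ε ≫ g)
    obtain ⟨l, ⟨h1, h2⟩, hl⟩ := (mem_rlp_iff p).1 hp ε hε a g ha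
    refine ⟨l, h2, fun l' h' => hl l' ⟨hA.hom_ext ?_, h'⟩⟩
    rw [Category.assoc, h', ha]

theorem liftsUniquely_puncturedBrick {E F : RelPrecubicalSet.{w}} {p : E ⟶ F}
    (hp : (generatingCofibrations.{w} n).rlp p) {ε : List Bool} (hε : ε.length = n) :
    LiftsUniquely (puncturedBrick ε) p :=
  liftsUniquely_puncturedBrick_aux hε fun _ h _ => liftsUniquely_brick hp h

theorem blowupMap_mem_rlp (n : ℕ) (P : RelPrecubicalSet.{w}) :
    (generatingCofibrations.{w} n).rlp (blowupMap n P) := by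
  rw [mem_rlp_iff]
  intro ε hε a b h
  refine ⟨classify hε b, ⟨?_, classify_comp_blowupMap hε b⟩, ?_⟩
  · ext k ⟨x, hx⟩
    obtain ⟨ε', v, rfl, rfl⟩ := exists_cell_eq x
    -- A nonminimal cell lies in a smaller brick contained in the punctured one. There `eq_classify`
    -- applies and forces `a` to agree with `classify hε b`.
    let i : brick.{w} ε' ⟶ puncturedBrick ε := restrictLift _ v.incl fun k y =>
      brick_cases (motive := fun k y => (⟨k, v.incl.app k y⟩ : Σ k, (brick.{w} ε).obj k) ≠ _)
        (fun ε'' v' => not_rel_brickMin_of_ne (v.incl.map_rel v'.rel_cell) hx) y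
    have hi : i ≫ brickIncl ε = v.incl := rfl
    have e : i ≫ a = v.incl ≫ classify hε b := by
      rw [eq_classify (v.length_eq.trans hε) (i ≫ a), incl_comp_classify, Category.assoc, h,
        ← Category.assoc, hi]
    exact congrArg (fun φ : brick.{w} ε' ⟶ blowup n P => φ.app _ (brickMin ε')) e.symm
  · rintro l ⟨-, rfl⟩
    exact eq_classify hε l

end RelPrecubicalSet

namespace RelPrecubicalSet
open RelPresheaf BrickWord

variable {n : ℕ} {P Q : RelPrecubicalSet.{w}}

/-! ## Charts -/

theorem rel_brickMin {ε : List Bool} {k : CubeCat} (x : (brick.{w} ε).obj k) :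
    (brick.{w} ε).rel x.1.2 x (brickMin ε) :=
  ⟨(Category.id_comp _).symm, x.2⟩

theorem faceWord_cellIndex {ε : List Bool} {k : CubeCat} (x : (brick.{w} ε).obj k) :
    (cellIndex x).2.faceWord = x.1.2.word := by
  refine brick_cases (motive := fun k x => (cellIndex x).2.faceWord = x.1.2.word) (fun ε' v => ?_) x
  rw [cellIndex_cell, cell_val_snd]
  rfl

/-- The target `ε` being fixed, `eq_of_faceWord_eq` says that the source and the face determine the
word, hence the cell. -/
theorem brick_ext {ε : List Bool} {k : CubeCat} {x y : (brick.{w} ε).obj k}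
    (h : (cellIndex x).1 = (cellIndex y).1) (h' : x.1.2.word = y.1.2.word) : x = y := by
  rw [← faceWord_cellIndex, ← faceWord_cellIndex] at h'
  have hx := cell_cellIndex x
  have hy := cell_cellIndex y
  generalize brickDim_cellIndex x = ex at hx
  generalize brickDim_cellIndex y = ey at hy
  generalize cellIndex x = i at *
  generalize cellIndex y = j at *
  obtain ⟨ε₁, v₁⟩ := i
  obtain ⟨ε₂, v₂⟩ := j
  obtain rfl : ε₁ = ε₂ := h
  obtain rfl := eq_of_heq (Sigma.mk.inj_iff.1 (eq_of_faceWord_eq v₁ v₂ h')).2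
  exact hx.symm.trans hy

theorem eq_brickMin {ε : List Bool} (x : (brick.{w} ε).obj (brickDim ε)) : x = brickMin ε := by
  have h := (cellIndex x).2.eq_id_of_count_le
    (count_true_eq (brickDim_cellIndex x) (cellIndex x).2.length_eq).ge
  refine brick_ext ?_ ?_
  · rw [cellIndex_brickMin]
    exact congrArg Sigma.fst h
  · rw [CubeCat.hom_self_eq_id x.1.2, CubeCat.hom_self_eq_id (brickMin ε).1.2]

theorem cellIndex_incl {ε' ε : List Bool} (v : BrickWord ε' ε) {k : CubeCat}
    (x : (brick.{w} ε').obj k) : (cellIndex (v.incl.app k x)).1 = (cellIndex x).1 := by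
  refine brick_cases
    (motive := fun k x => (cellIndex (v.incl.app k x)).1 = (cellIndex x).1) (fun ε'' v' => ?_) x
  rw [incl_cell, cellIndex_cell, cellIndex_cell]

theorem incl_injective {ε' ε : List Bool} (v : BrickWord ε' ε) {k : CubeCat}
    {x y : (brick.{w} ε').obj k} (h : v.incl.app k x = v.incl.app k y)
    (h' : x.1.2.word = y.1.2.word) : x = y :=
  brick_ext (by rw [← cellIndex_incl v, h, cellIndex_incl]) h'

theorem finite_cells (ε : List Bool) (k : CubeCat) (f : FaceWord) :
    Finite {x : (brick.{w} ε).obj k // x.1.2.word = f} := by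
  have := (List.finite_length_eq Bool ε.length).to_subtype
  refine Finite.of_injective (β := {l : List Bool | l.length = ε.length})
    (fun x => ⟨(cellIndex x.1).1, (cellIndex x.1).2.length_eq⟩) fun x y h => ?_
  exact Subtype.ext (brick_ext (congrArg Subtype.val h) (x.2.trans y.2.symm))

/-- The morphism from a brick `ε` to the upward neighborhood of the image of its minimal cube. -/
def toUp {ε : List Bool} (ψ : brick ε ⟶ P) : brick ε ⟶ P.up (ψ.app _ (brickMin ε)) :=
  Hom.mk (fun k x => ⟨(ψ.app k x, x.1.2), ψ.map_rel (rel_brickMin x)⟩)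
    (fun h => ⟨h.1, ψ.map_rel h⟩)

/-- The cubes above `f` in the blowup are the `v.incl ≫ f`. The source and face of `v` can be read
off from them, which also gives injectivity. -/
theorem isChart_toUp_classify {ε : List Bool} (hε : ε.length = n) (f : brick ε ⟶ P) :
    IsChart (toUp (classify hε f)) := by
  constructor
  · rintro k ⟨⟨⟨⟨ε', f'⟩, h, rfl⟩, g⟩, hd⟩
    rw [classify_brickMin] at hd
    obtain ⟨v, h1, h2⟩ := blowup_rel_iff.1 hd
    refine ⟨v.cell, Subtype.ext (Prod.ext ?_ ?_)⟩
    · refine (classify_cell hε f v).trans (Subtype.ext ?_)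
      exact congrArg (Sigma.mk ε') h2.symm
    · exact (cell_val_snd.{w} v).trans (CubeCat.hom_ext h1)
  · intro k a b hab _ e
    have e1 := congrArg (fun z => z.1.1.1.1) e
    have e2 := congrArg (fun z => z.1.2.word) e
    exact hab (brick_ext e1 e2)

theorem isEuclidean_blowup (n : ℕ) (P : RelPrecubicalSet.{w}) : IsEuclidean n (blowup n P) := by
  rintro _ ⟨⟨ε, f⟩, h, rfl⟩
  rw [← classify_brickMin h f]
  exact ⟨ε, h, _, isChart_toUp_classify h f⟩

/-- `ψ` induces a bijection from the cells of the brick to those of the upward neighborhood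
of `c`. -/
structure IsChartAt {m : CubeCat} (c : P.obj m) {ε : List Bool} (ψ : brick ε ⟶ P) : Prop where
  dim_eq : brickDim ε = m
  app_brickMin : dim_eq ▸ ψ.app _ (brickMin ε) = c
  surj : ∀ ⦃k : CubeCat⦄ (d : P.obj k) (f : m ⟶ k), P.rel f d c →
    ∃ x : (brick ε).obj k, x.1.2.word = f.word ∧ ψ.app k x = d
  inj : ∀ ⦃k : CubeCat⦄ (x y : (brick ε).obj k), x.1.2.word = y.1.2.word →
    ψ.app k x = ψ.app k y → x = y

theorem exists_rel_app {m : CubeCat} {c : P.obj m} {ε : List Bool} {ψ : brick ε ⟶ P}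
    (h : brickDim ε = m) (hc : h ▸ ψ.app _ (brickMin ε) = c) {k : CubeCat} (x : (brick ε).obj k) :
    ∃ f : m ⟶ k, f.word = x.1.2.word ∧ P.rel f (ψ.app k x) c := by
  subst h hc
  exact ⟨x.1.2, rfl, ψ.map_rel (rel_brickMin x)⟩

theorem dim_le_of_hom {k l : CubeCat} (f : k ⟶ l) : k.dim ≤ l.dim := by
  rw [← f.count_eq, ← f.length_eq]
  exact List.count_le_length

theorem IsChart.exists_isChartAt {m : CubeCat} {c : P.obj m} {ε : List Bool}
    {φ : brick ε ⟶ P.up c} (hφ : IsChart φ) : ∃ ψ : brick ε ⟶ P, IsChartAt c ψ := by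
  obtain ⟨x, hx⟩ := hφ.1 m ⟨(c, 𝟙 m), P.rel_id c⟩
  -- A preimage of `(c, 𝟙 m)` gives a morphism `brickDim ε ⟶ m`, and the image of the minimal cube
  -- gives one in the other direction.
  have e : brickDim ε = m := CubeCat.ext
    (le_antisymm (dim_le_of_hom x.1.2) (dim_le_of_hom (φ.app _ (brickMin ε)).1.2))
  subst e
  obtain rfl := eq_brickMin x
  have hw {k : CubeCat} (x : (brick ε).obj k) : (φ.app k x).1.2 = x.1.2 := by
    have := (φ.map_rel (rel_brickMin x)).1
    rw [hx] at this
    exact this.trans (Category.id_comp _)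
  let π : P.up c ⟶ P := Hom.mk (fun _ x => x.1.1) (fun h => h.2)
  refine ⟨φ ≫ π, rfl, congrArg (fun z => z.1.1) hx, fun k d f hd => ?_, fun k x y h h' => ?_⟩
  · obtain ⟨x, hx'⟩ := hφ.1 k ⟨(d, f), hd⟩
    refine ⟨x, ?_, congrArg (fun z => z.1.1) hx'⟩
    rw [← hw x, hx']
  · by_contra hxy
    have e : x.1.2 = y.1.2 := CubeCat.hom_ext h
    -- Two cells over the same morphism have the minimal cube as a common face, so the local
    -- condition is injectivity over each morphism.
    refine hφ.2 x y hxy ⟨_, x.1.2, brickMin ε, rel_brickMin x, ?_⟩ ?_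
    · rw [e]
      exact rel_brickMin y
    · exact Subtype.ext (Prod.ext h' (by rw [hw, hw, e]))

/-- The chart `φ` lifts the image of a top cell of `B_ε` to a top cell of `B_δ` with the same face.
For a top cell the source is known, so the face determines the brick. -/
theorem IsChartAt.eq_of_length_eq {m : CubeCat} {c : P.obj m} {ε δ : List Bool} {φ : brick δ ⟶ P}
    (hφ : IsChartAt c φ) {ψ : brick ε ⟶ P} (h : brickDim ε = m)
    (hc : h ▸ ψ.app _ (brickMin ε) = c) (hl : ε.length = δ.length) : ε = δ := by
  obtain ⟨f, hf, hr⟩ := exists_rel_app h hc (top ε).cell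
  obtain ⟨x, hx, -⟩ := hφ.surj _ f hr
  rw [hf, cell_val_snd, ← faceWord_cellIndex] at hx
  have h1 := brickDim_cellIndex x
  generalize cellIndex x = i at *
  obtain ⟨ε', v⟩ := i
  obtain rfl := eq_replicate_of_brickDim (v.length_eq.trans hl.symm) h1
  exact (congrArg Sigma.fst (eq_of_faceWord_eq v (top ε) hx)).symm

/-- Both bricks are equal, and `ψ` factors cellwise through the chart `φ` as an injective self-map
of the finite set of cells over a given morphism; such a map is surjective. -/
theorem IsChartAt.of_injective {m : CubeCat} {c : P.obj m} {ε δ : List Bool} {φ : brick δ ⟶ P}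
    (hφ : IsChartAt c φ) {ψ : brick ε ⟶ P} (h : brickDim ε = m)
    (hc : h ▸ ψ.app _ (brickMin ε) = c) (hl : ε.length = δ.length)
    (hψ : ∀ ⦃k : CubeCat⦄ (x y : (brick ε).obj k), x.1.2.word = y.1.2.word →
      ψ.app k x = ψ.app k y → x = y) : IsChartAt c ψ := by
  obtain rfl := hφ.eq_of_length_eq h hc hl
  refine ⟨h, hc, fun k d f hd => ?_, hψ⟩
  have H (x : {x : (brick.{w} ε).obj k // x.1.2.word = f.word}) :
      ∃ y : {x : (brick.{w} ε).obj k // x.1.2.word = f.word}, φ.app k y.1 = ψ.app k x.1 := by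
    obtain ⟨f', hf', hr⟩ := exists_rel_app h hc x.1
    obtain ⟨y, hy, hy'⟩ := hφ.surj _ f' hr
    exact ⟨⟨y, hy.trans (hf'.trans x.2)⟩, hy'⟩
  choose σ hσ using H
  have := finite_cells.{w} ε k f.word
  have hinj : Function.Injective σ := fun x y e =>
    Subtype.ext (hψ _ _ (x.2.trans y.2.symm) (by rw [← hσ, ← hσ, e]))
  obtain ⟨y, hy, rfl⟩ := hφ.surj d f hd
  obtain ⟨x, hx⟩ := Finite.injective_iff_surjective.1 hinj ⟨y, hy⟩
  exact ⟨x.1, x.2, by rw [← hσ, hx]⟩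

/-! ### Uniqueness of charts and the section of the blowup map. -/

theorem IsEuclidean.exists_isChartAt (hP : IsEuclidean n P) {m : CubeCat} (c : P.obj m) :
    ∃ ε : List Bool, ε.length = n ∧ ∃ ψ : brick ε ⟶ P, IsChartAt c ψ := by
  obtain ⟨ε, hε, φ, hφ⟩ := hP c
  exact ⟨ε, hε, hφ.exists_isChartAt⟩

/-- Injectivity is inherited from `φ`; surjectivity follows by counting against the chart that
euclideanity provides at the image cube. -/
theorem IsEuclidean.isChartAt_incl (hP : IsEuclidean n P) {m : CubeCat} {c : P.obj m}
    {ε' ε : List Bool} (hε : ε.length = n) {φ : brick ε ⟶ P} (hφ : IsChartAt c φ)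
    (v : BrickWord ε' ε) : IsChartAt (φ.app _ v.cell) (v.incl ≫ φ) := by
  obtain ⟨δ, hδ, χ, hχ⟩ := hP.exists_isChartAt (φ.app _ v.cell)
  refine hχ.of_injective rfl rfl (v.length_eq.trans (hε.trans hδ.symm)) fun k x y h h' => ?_
  have e : x.1.2 = y.1.2 := CubeCat.hom_ext h
  refine incl_injective v (hφ.inj _ _ ?_ h') h
  change CubeHom.word (v.face ≫ x.1.2) = CubeHom.word (v.face ≫ y.1.2)
  rw [e]

/-- Charts reflect relations: the restriction of `φ` at `y` is a chart, so the relation in `P` lifts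
to a cell above `y`, which injectivity of `φ` identifies with `x`. -/
theorem IsEuclidean.rel_of_rel_app (hP : IsEuclidean n P) {m : CubeCat} {c : P.obj m}
    {ε : List Bool} (hε : ε.length = n) {φ : brick ε ⟶ P} (hφ : IsChartAt c φ) {k l : CubeCat}
    {g : l ⟶ k} {x : (brick ε).obj k} {y : (brick ε).obj l} (h : x.1.2 = y.1.2 ≫ g)
    (h' : P.rel g (φ.app k x) (φ.app l y)) : (brick ε).rel g x y := by
  obtain ⟨ε', v, rfl, rfl⟩ := exists_cell_eq y
  obtain ⟨z, hz, hz'⟩ := (hP.isChartAt_incl hε hφ v).surj _ g h'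
  obtain rfl : z.1.2 = g := CubeCat.hom_ext hz
  obtain rfl : v.incl.app k z = x := by
    refine hφ.inj _ _ ?_ hz'
    rw [h, cell_val_snd]
    rfl
  exact v.incl.map_rel (rel_brickMin z)

/-- By `eq_classify`, `σ ≫ classify rfl (𝟙 _)` equals `classify rfl σ`. At the minimal cube, which
`σ` fixes as the only cell of its dimension, the two sides are `𝟙` and `σ`. -/
theorem brick_endomorphism_eq_id {ε : List Bool} (σ : brick.{w} ε ⟶ brick ε) : σ = 𝟙 _ := by
  have h := eq_classify rfl (σ ≫ classify rfl (𝟙 (brick.{w} ε)))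
  have h' := congrArg (fun φ : brick ε ⟶ blowup _ _ => φ.app _ (brickMin ε)) h
  rw [Category.assoc, classify_comp_blowupMap, Category.comp_id] at h'
  simp only [comp_app] at h'
  rw [classify_brickMin, eq_brickMin (σ.app _ _), classify_brickMin] at h'
  exact (eq_of_heq (Sigma.mk.inj_iff.1 (congrArg Subtype.val h')).2).symm

/-- Two charts at `c` differ by a cellwise comparison `σ`; it preserves relations because charts
reflect them, so rigidity of bricks makes it the identity. -/
theorem IsEuclidean.isChartAt_unique (hP : IsEuclidean n P) {m : CubeCat} {c : P.obj m}
    {ε δ : List Bool} (hε : ε.length = n) (hδ : δ.length = n) {ψ : brick ε ⟶ P} {φ : brick δ ⟶ P}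
    (hψ : IsChartAt c ψ) (hφ : IsChartAt c φ) :
    (⟨ε, ψ⟩ : Σ ε, (brick ε ⟶ P)) = ⟨δ, φ⟩ := by
  obtain rfl := hφ.eq_of_length_eq hψ.dim_eq hψ.app_brickMin (hε.trans hδ.symm)
  have H (k : CubeCat) (x : (brick ε).obj k) :
      ∃ y : (brick ε).obj k, y.1.2 = x.1.2 ∧ φ.app k y = ψ.app k x := by
    obtain ⟨f, hf, hr⟩ := exists_rel_app hψ.dim_eq hψ.app_brickMin x
    obtain ⟨y, hy, hy'⟩ := hφ.surj _ f hr
    exact ⟨y, CubeCat.hom_ext (hy.trans hf), hy'⟩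
  choose σ hσ hσ' using H
  let σ' : brick ε ⟶ brick ε := Hom.mk σ (by
    intro k l g x y h
    refine hP.rel_of_rel_app hδ hφ ?_ ?_
    · rw [hσ, hσ]
      exact h.1
    · rw [hσ', hσ']
      exact ψ.map_rel h)
  have e : σ' ≫ φ = ψ := by
    ext k x
    exact hσ' k x
  rw [← e, brick_endomorphism_eq_id σ', Category.id_comp]

theorem IsEuclidean.exists_section (hP : IsEuclidean n P) :
    ∃ s : P ⟶ blowup n P, s ≫ blowupMap n P = 𝟙 P := by
  choose ε hε φ hφ using fun k (c : P.obj k) => hP.exists_isChartAt c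
  refine ⟨Hom.mk (fun k c => ⟨⟨ε k c, φ k c⟩, hε k c, (hφ k c).dim_eq⟩) ?_, ?_⟩
  · intro k l g d c h
    obtain ⟨x, hx, hx'⟩ := (hφ l c).surj d g h
    obtain ⟨ε', v, rfl, rfl⟩ := exists_cell_eq x
    -- The cube `d` is a cell `v` of the chart at `c`. The restriction of that chart along `v` is a
    -- chart at `d`, hence the chosen one, which is the relation required in the blowup.
    have h1 := hP.isChartAt_incl (hε l c) (hφ l c) v
    rw [hx'] at h1
    have h2 := hP.isChartAt_unique (v.length_eq.trans (hε l c)) (hε _ d) h1 (hφ _ d)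
    have key : ∀ z : Σ ε, (brick ε ⟶ P), ⟨ε', v.incl ≫ φ l c⟩ = z →
        ∃ u : BrickWord z.1 (ε l c), u.faceWord = g.word ∧ z.2 = u.incl ≫ φ l c := by
      rintro _ rfl
      refine ⟨v, ?_, rfl⟩
      rw [← hx, cell_val_snd]
      rfl
    exact blowup_rel_iff.2 (key _ h2)
  · ext k c
    exact (hφ k c).app_brickMin

theorem liftsUniquely_of_exists_section {E F : RelPrecubicalSet.{w}} {p : E ⟶ F}
    (hp : (generatingCofibrations.{w} n).rlp p)
    (h : ∃ s : P ⟶ blowup n P, s ≫ blowupMap n P = 𝟙 P) : LiftsUniquely P p := by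
  obtain ⟨s, hs⟩ := h
  exact liftsUniquely_of_section p s hs fun k c => liftsUniquely_brick hp (s.app k c).2.1

theorem IsEuclidean.of_iso (e : P ≅ Q) (hP : IsEuclidean n P) : IsEuclidean n Q := by
  have h1 {k : CubeCat} (x : P.obj k) : e.inv.app k (e.hom.app k x) = x :=
    congrArg (fun φ : P ⟶ P => φ.app k x) e.hom_inv_id
  have h2 {k : CubeCat} (x : Q.obj k) : e.hom.app k (e.inv.app k x) = x :=
    congrArg (fun φ : Q ⟶ Q => φ.app k x) e.inv_hom_id
  intro m c
  obtain ⟨c, rfl⟩ : ∃ d, e.hom.app m d = c := ⟨_, h2 c⟩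
  obtain ⟨ε, hε, φ, hφ⟩ := hP c
  let u : P.up c ⟶ Q.up (e.hom.app m c) :=
    Hom.mk (fun k x => ⟨(e.hom.app k x.1.1, x.1.2), e.hom.map_rel x.2⟩)
      (fun h => ⟨h.1, e.hom.map_rel h.2⟩)
  refine ⟨ε, hε, φ ≫ u, ?_, ?_⟩
  · rintro k ⟨⟨d, f⟩, h⟩
    have h' := e.inv.map_rel h
    rw [h1] at h'
    obtain ⟨x, hx⟩ := hφ.1 k ⟨(_, f), h'⟩
    refine ⟨x, Subtype.ext (Prod.ext ?_ ?_)⟩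
    · change e.hom.app k (φ.app k x).1.1 = d
      rw [hx, h2]
    · change (φ.app k x).1.2 = f
      rw [hx]
  · intro k a b hab h hab'
    refine hφ.2 a b hab h (Subtype.ext (Prod.ext ?_ ?_))
    · rw [← h1 (φ.app k a).1.1, ← h1 (φ.app k b).1.1]
      exact congrArg (fun z => e.inv.app k z.1.1) hab'
    · exact congrArg (fun z => z.1.2) hab'

end RelPrecubicalSet

namespace RelPresheaf

/-! ### Limits of relational presheaves -/

section Limits

variable {C : Type u} [Category.{v} C] {J : Type} [SmallCategory J]

/-- The limit of a diagram of relational presheaves. -/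
def limitObj (D : J ⥤ RelPresheaf.{w} C) : RelPresheaf.{w} C where
  obj c := {x : ∀ j, (D.obj j).obj c // ∀ ⦃j j' : J⦄ (f : j ⟶ j'),
    Hom.app (D.map f) c (x j) = x j'}
  rel f x y := ∀ j, (D.obj j).rel f (x.1 j) (y.1 j)
  rel_id x j := (D.obj j).rel_id (x.1 j)
  rel_comp h h' j := (D.obj j).rel_comp (h j) (h' j)

/-- The limit cone. -/
def limitCone (D : J ⥤ RelPresheaf.{w} C) : Cone D where
  pt := limitObj D
  π :=
    { app := fun j => Hom.mk (fun c x => x.1 j) (fun h => h j)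
      naturality := fun i j f => by
        ext c x
        exact (x.2 f).symm }

/-- The limit cone is universal. -/
def limitConeIsLimit (D : J ⥤ RelPresheaf.{w} C) : IsLimit (limitCone D) where
  lift s := Hom.mk (fun c x => ⟨fun j => Hom.app (s.π.app j) c x, fun j j' f =>
    congrArg (fun α : s.pt ⟶ D.obj j' => α.app c x) (s.w f)⟩) (fun h j => (s.π.app j).map_rel h)
  fac s j := rfl
  uniq s m hm := by
    ext c x
    exact Subtype.ext (funext fun j => congrArg (fun α : s.pt ⟶ D.obj j => α.app c x) (hm j))

instance : HasLimitsOfShape J (RelPresheaf.{w} C) :=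
  ⟨fun D => ⟨⟨⟨_, limitConeIsLimit D⟩⟩⟩⟩

instance : HasFiniteLimits (RelPresheaf.{w} C) := ⟨fun _ _ _ => inferInstance⟩

instance : HasFiniteColimits (RelPresheaf.{w} C) := ⟨fun _ _ _ => inferInstance⟩

end Limits

end RelPresheaf

namespace RelPrecubicalSet
open RelPresheaf BrickWord

/-! ## The factorization of a morphism -/

section Factorization

variable {n : ℕ} {X Y : RelPrecubicalSet.{w}} {f : X ⟶ Y}

/-- A factorization of `f` whose second morphism is right orthogonal to the inclusions of punctured
bricks. -/
structure OrthogonalFactorization (n : ℕ) (f : X ⟶ Y) where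
  E : RelPrecubicalSet.{w}
  i : X ⟶ E
  p : E ⟶ Y
  fac : i ≫ p = f
  hp : (generatingCofibrations.{w} n).rlp p

/-- Formal cubes obtained from those of `X` by adding minimal cubes of bricks over `Y`. -/
inductive FormalCube (n : ℕ) (X Y : RelPrecubicalSet.{w}) : CubeCat → Type w
  | of {k : CubeCat} (x : X.obj k) : FormalCube n X Y k
  | lift (ε : List Bool) (hε : ε.length = n) (b : brick.{w} ε ⟶ Y)
      (a : ∀ k : CubeCat, (puncturedBrick.{w} ε).obj k → FormalCube n X Y k) :
      FormalCube n X Y (brickDim ε)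

namespace OrthogonalFactorization

/-- The formal cube `t` has the value `e`. -/
def Evaluates (F : OrthogonalFactorization n f) :
    ∀ {k : CubeCat}, FormalCube n X Y k → F.E.obj k → Prop
  | _, .of x, e => F.i.app _ x = e
  | _, .lift ε _ b a, e => ∃ φ : brick ε ⟶ F.E, φ ≫ F.p = b ∧
      (∀ k y, F.Evaluates (a k y) ((brickIncl ε ≫ φ).app k y)) ∧ φ.app _ (brickMin ε) = e

/-- The values of `a` fix the restriction to the punctured brick, and orthogonality then leaves one
extension over `b`. -/
theorem Evaluates.unique {F : OrthogonalFactorization n f} {k : CubeCat} {t : FormalCube n X Y k}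
    {e e' : F.E.obj k} (h : F.Evaluates t e) (h' : F.Evaluates t e') : e = e' := by
  induction t with
  | of x => exact h.symm.trans h'
  | lift ε hε b a ih =>
    obtain ⟨φ, h1, h2, rfl⟩ := h
    obtain ⟨φ', h1', h2', rfl⟩ := h'
    have e : brickIncl ε ≫ φ = brickIncl ε ≫ φ' := by
      ext k y
      exact ih k y (h2 k y) (h2' k y)
    obtain rfl : φ = φ' :=
      ((mem_rlp_iff F.p).1 F.hp ε hε (brickIncl ε ≫ φ) b (by rw [Category.assoc, h1])).unique
        ⟨rfl, h1⟩ ⟨e.symm, h1'⟩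
    rfl

theorem Evaluates.map {F G : OrthogonalFactorization n f} (u : F.E ⟶ G.E) (hi : F.i ≫ u = G.i)
    (hp : u ≫ G.p = F.p) {k : CubeCat} {t : FormalCube n X Y k} {e : F.E.obj k}
    (h : F.Evaluates t e) : G.Evaluates t (u.app k e) := by
  induction t with
  | of x =>
    obtain rfl := h
    exact congrArg (fun α : X ⟶ G.E => α.app _ x) hi.symm
  | lift ε hε b a ih =>
    obtain ⟨φ, h1, h2, rfl⟩ := h
    exact ⟨φ ≫ u, by rw [Category.assoc, hp, h1], fun k y => ih k y (h2 k y), rfl⟩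

end OrthogonalFactorization

open OrthogonalFactorization

/-- The formal cubes that have a value in every factorization. -/
def ValidCube (n : ℕ) (f : X ⟶ Y) (k : CubeCat) : Type w :=
  {t : FormalCube n X Y k // ∀ F : OrthogonalFactorization n f, ∃ e, F.Evaluates t e}

/-- The value of a formal cube. -/
noncomputable def ValidCube.value {k : CubeCat} (t : ValidCube n f k)
    (F : OrthogonalFactorization n f) : F.E.obj k :=
  (t.2 F).choose

theorem ValidCube.evaluates {k : CubeCat} (t : ValidCube n f k)
    (F : OrthogonalFactorization n f) : F.Evaluates t.1 (t.value F) :=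
  (t.2 F).choose_spec

/-- The value in the factorization `F` of a cube of the initial factorization. -/
noncomputable def initialValue (F : OrthogonalFactorization n f) {k : CubeCat}
    (z : Quotient (Setoid.ker (ValidCube.value (n := n) (f := f) (k := k)))) : F.E.obj k :=
  z.out.value F

theorem initialValue_mk (F : OrthogonalFactorization n f) {k : CubeCat} (t : ValidCube n f k) :
    initialValue F ⟦t⟧ = t.value F :=
  congrFun (Quotient.mk_out (s := Setoid.ker (ValidCube.value (n := n) (f := f) (k := k))) t) F

theorem initialValue_ext {k : CubeCat}
    {z z' : Quotient (Setoid.ker (ValidCube.value (n := n) (f := f) (k := k)))}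
    (h : ∀ F : OrthogonalFactorization n f, initialValue F z = initialValue F z') : z = z' := by
  rw [← z.out_eq, ← z'.out_eq]
  exact Quotient.sound (s := Setoid.ker _) (funext h)

/-- The middle object of the initial factorization. -/
noncomputable def initialObj (n : ℕ) (f : X ⟶ Y) : RelPrecubicalSet.{w} where
  -- The factorizations form a larger type, but this quotient of formal cubes stays in `Type w`.
  -- Relations are those holding in all factorizations, so morphisms into this object can be tested
  -- there.
  obj k := Quotient (Setoid.ker (ValidCube.value (n := n) (f := f) (k := k)))
  rel g z z' := ∀ F : OrthogonalFactorization n f, F.E.rel g (initialValue F z) (initialValue F z')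
  rel_id _ F := F.E.rel_id _
  rel_comp h h' F := F.E.rel_comp (h F) (h' F)

/-- The morphism from the initial factorization to `F`. -/
noncomputable def initialHom (F : OrthogonalFactorization n f) : initialObj n f ⟶ F.E :=
  Hom.mk (fun _ z => initialValue F z) (fun h => h F)

theorem initialObj_ext {k : CubeCat} {z z' : (initialObj n f).obj k}
    (h : ∀ F : OrthogonalFactorization n f, (initialHom F).app k z = (initialHom F).app k z') :
    z = z' :=
  initialValue_ext h

theorem exists_initialHom_app {k : CubeCat} (t : FormalCube n X Y k)
    (e : ∀ F : OrthogonalFactorization n f, F.E.obj k) (h : ∀ F : OrthogonalFactorization n f, F.Evaluates t (e F)) :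
    ∃ z : (initialObj n f).obj k, ∀ F, (initialHom F).app k z = e F :=
  ⟨⟦⟨t, fun F => ⟨e F, h F⟩⟩⟧, fun F => (initialValue_mk F _).trans
    ((ValidCube.evaluates _ F).unique (h F))⟩

theorem exists_evaluates_initialHom {k : CubeCat} (z : (initialObj n f).obj k) :
    ∃ t : FormalCube n X Y k, ∀ F : OrthogonalFactorization n f,
      F.Evaluates t ((initialHom F).app k z) :=
  ⟨(Quotient.out z : ValidCube n f k).1, fun F => ValidCube.evaluates _ F⟩

/-- A morphism to the middle object of the initial factorization, given by its values. -/
theorem exists_initialObj_lift {R : RelPrecubicalSet.{w}}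
    (g : ∀ F : OrthogonalFactorization n f, R ⟶ F.E)
    (h : ∀ k (x : R.obj k), ∃ z : (initialObj n f).obj k,
      ∀ F, (initialHom F).app k z = (g F).app k x) :
    ∃ l : R ⟶ initialObj n f, ∀ F, l ≫ initialHom F = g F := by
  choose l hl using h
  refine ⟨Hom.mk l fun {k k'} α x y hxy F => ?_, fun F => ?_⟩
  · change F.E.rel α ((initialHom F).app k (l k x)) ((initialHom F).app k' (l k' y))
    rw [hl, hl]
    exact (g F).map_rel hxy
  · ext k x
    exact hl k x F

theorem initialObj_hom_ext {R : RelPrecubicalSet.{w}} {l l' : R ⟶ initialObj n f}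
    (h : ∀ F : OrthogonalFactorization n f, l ≫ initialHom F = l' ≫ initialHom F) : l = l' := by
  ext k x
  exact initialObj_ext fun F => congrArg (fun α : R ⟶ F.E => α.app k x) (h F)

variable (n f)

theorem exists_initial_i : ∃ i : X ⟶ initialObj n f, ∀ F, i ≫ initialHom F = F.i :=
  exists_initialObj_lift (fun F => F.i) fun _ x =>
    exists_initialHom_app (.of x) (fun F => F.i.app _ x) fun _ => rfl

/-- The factorization `𝟙 ≫ f`. -/
def terminalFactorization : OrthogonalFactorization n f where
  E := Y
  i := f
  p := 𝟙 Y
  fac := Category.comp_id f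
  hp := MorphismProperty.id_mem _ Y

theorem initialHom_comp_p (F : OrthogonalFactorization n f) :
    initialHom F ≫ F.p = initialHom (terminalFactorization n f) := by
  ext k z
  obtain ⟨t, ht⟩ := exists_evaluates_initialHom z
  exact ((ht F).map (G := terminalFactorization n f) F.p F.fac (Category.comp_id _)).unique (ht _)

/-- The square has a unique lift in each factorization. These lifts come from one morphism to the
initial object because a single formal cube `.lift` evaluates to all their values at the minimal
cube. -/
theorem initialHom_terminalFactorization_mem_rlp :
    (generatingCofibrations.{w} n).rlp (initialHom (terminalFactorization n f)) := by
  rw [mem_rlp_iff]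
  intro ε hε a b h
  have H (F : OrthogonalFactorization n f) :=
    (mem_rlp_iff F.p).1 F.hp ε hε (a ≫ initialHom F) b
      (by rw [Category.assoc, initialHom_comp_p]; exact h)
  choose l hl hl' using H
  have hl1 (F) := (hl F).1
  obtain ⟨l₀, hl₀⟩ := exists_initialObj_lift l (by
    intro k x
    by_cases hx : (⟨k, x⟩ : Σ k, (brick.{w} ε).obj k) = ⟨_, brickMin ε⟩
    · obtain ⟨rfl, hx⟩ := Sigma.mk.inj_iff.1 hx
      obtain rfl := eq_of_heq hx
      choose t ht using fun k (y : (puncturedBrick ε).obj k) =>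
        exists_evaluates_initialHom (a.app k y)
      refine exists_initialHom_app (.lift ε hε b t) (fun F => (l F).app _ (brickMin ε)) fun F =>
        ⟨l F, (hl F).2, fun k y => ?_, rfl⟩
      have := congrArg (fun α : puncturedBrick ε ⟶ F.E => α.app k y) (hl1 F)
      exact (congrArg (F.Evaluates (t k y)) this).mpr (ht k y F)
    · refine ⟨a.app k ⟨x, hx⟩, fun F => ?_⟩
      exact congrArg (fun α : puncturedBrick ε ⟶ F.E => α.app k ⟨x, hx⟩) (hl1 F).symm)
  refine ⟨l₀, ⟨initialObj_hom_ext fun F => ?_, ?_⟩, fun l' h' => initialObj_hom_ext fun F => ?_⟩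
  · rw [Category.assoc, hl₀, hl1]
  · rw [hl₀, ← (hl (terminalFactorization n f)).2]
    exact (Category.comp_id _).symm
  · rw [hl₀]
    refine hl' F _ ⟨?_, ?_⟩
    · rw [← h'.1, Category.assoc]
    · rw [Category.assoc, initialHom_comp_p]
      exact h'.2

/-- The first morphism lifts against any `q` in the right class because pulling `q` back along `b`
gives another factorization, to which the initial one maps. -/
theorem exists_factorization : ∃ (Z : RelPrecubicalSet.{w}) (i : X ⟶ Z) (p : Z ⟶ Y),
    i ≫ p = f ∧ (generatingCofibrations.{w} n).rlp.llp i ∧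
      (generatingCofibrations.{w} n).rlp p := by
  obtain ⟨i, hi⟩ := exists_initial_i n f
  let I : OrthogonalFactorization n f :=
    ⟨initialObj n f, i, _, hi _, initialHom_terminalFactorization_mem_rlp n f⟩
  have hI : initialHom I = 𝟙 (initialObj n f) := by
    refine initialObj_hom_ext fun F => ?_
    ext k z
    obtain ⟨t, ht⟩ := exists_evaluates_initialHom z
    exact ((ht I).map (initialHom F) (hi F) (initialHom_comp_p n f F)).unique (ht F)
  -- Evaluation of formal cubes is natural and single-valued, so an endomorphism of the initial
  -- factorization fixes every cube.
  have huniq (r : initialObj n f ⟶ initialObj n f) (h : i ≫ r = i) (h' : r ≫ I.p = I.p) :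
      r = 𝟙 _ := by
    ext k z
    obtain ⟨t, ht⟩ := exists_evaluates_initialHom z
    have h1 := ht I
    rw [hI] at h1
    exact (h1.map (F := I) (G := I) r h h').unique h1
  refine ⟨_, i, I.p, I.fac, fun E F q hq => ⟨fun {a b} sq => ?_⟩, I.hp⟩
  let G : OrthogonalFactorization n f :=
    ⟨pullback b q, pullback.lift i a sq.w.symm, pullback.fst b q ≫ I.p,
      by rw [pullback.lift_fst_assoc, I.fac],
      MorphismProperty.comp_mem _ _ _ (MorphismProperty.pullback_fst _ _ hq) I.hp⟩
  -- The map to `G` thus splits the projection of the pullback; its other component is the required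
  -- lift.
  have e : initialHom G ≫ pullback.fst b q = 𝟙 _ := by
    refine huniq _ ?_ ?_
    · rw [← Category.assoc, hi]
      exact pullback.lift_fst _ _ _
    · rw [Category.assoc]
      exact initialHom_comp_p n f G
  refine ⟨⟨⟨initialHom G ≫ pullback.snd b q, ?_, ?_⟩⟩⟩
  · rw [← Category.assoc, hi]
    exact pullback.lift_snd _ _ _
  · rw [Category.assoc, ← pullback.condition, ← Category.assoc, e, Category.id_comp]

end Factorization

/-! ## The model structure -/

variable {n : ℕ} {P Q : RelPrecubicalSet.{w}}

instance hasTwoOutOfThreeProperty_rlp (n : ℕ) :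
    (generatingCofibrations.{w} n).rlp.HasTwoOutOfThreeProperty where
  of_postcomp f g hg hfg := by
    rw [mem_rlp_iff] at hg hfg ⊢
    intro ε hε a b h
    obtain ⟨l, ⟨h1, h2⟩, hl⟩ := hfg ε hε a (b ≫ g)
      (by rw [← Category.assoc, h, Category.assoc])
    refine ⟨l, ⟨h1, (hg ε hε (a ≫ f) (b ≫ g) (by rw [h, Category.assoc])).unique
      ⟨by rw [← Category.assoc, h1], by rw [Category.assoc, h2]⟩ ⟨h.symm, rfl⟩⟩, ?_⟩
    rintro l' ⟨h1', h2'⟩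
    exact hl l' ⟨h1', by rw [← h2', Category.assoc]⟩
  of_precomp f g hf hfg := by
    rw [mem_rlp_iff] at hfg ⊢
    intro ε hε a b h
    -- Squares over `g` are transported to squares over `f ≫ g` by lifting through `f`, which needs
    -- unique lifting of the whole punctured brick and brick, not only relative lifting.
    have hA := liftsUniquely_puncturedBrick hf hε
    have hB := liftsUniquely_brick hf hε
    obtain ⟨a', rfl, -⟩ := hA a
    have huniq := hfg ε hε a' b (by rw [← h, Category.assoc])
    obtain ⟨l, ⟨rfl, h2⟩, -⟩ := id huniq
    refine ⟨l ≫ f, ⟨(Category.assoc _ _ _).symm, by rw [Category.assoc, h2]⟩, ?_⟩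
    rintro m ⟨h1', h2'⟩
    obtain ⟨m, rfl, -⟩ := hB m
    have h1 : brickIncl ε ≫ m = brickIncl ε ≫ l := hA.hom_ext ((Category.assoc _ _ _).trans h1')
    have h2'' : m ≫ f ≫ g = b := (Category.assoc _ _ _).symm.trans h2'
    exact congrArg (· ≫ f) (huniq.unique ⟨h1, h2''⟩ ⟨rfl, h2⟩)

theorem llp_initial_iff (P : RelPrecubicalSet.{w}) :
    (generatingCofibrations.{w} n).rlp.llp (initial.to P) ↔
      ∃ s : P ⟶ blowup n P, s ≫ blowupMap n P = 𝟙 P := by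
  constructor
  · intro h
    have := h _ (blowupMap_mem_rlp n P)
    have sq : CommSq (initial.to _) (initial.to P) (blowupMap n P) (𝟙 P) :=
      ⟨Subsingleton.elim _ _⟩
    exact ⟨sq.lift, sq.fac_right⟩
  · intro h E F p hp
    refine ⟨fun {a b} sq => ?_⟩
    obtain ⟨l, hl, -⟩ := liftsUniquely_of_exists_section hp h b
    exact ⟨⟨⟨l, Subsingleton.elim _ _, hl⟩⟩⟩

theorem existsUnique_iso_blowup {q : Q ⟶ P} (hq : (generatingCofibrations.{w} n).rlp q)
    (hQ : ∃ s : Q ⟶ blowup n Q, s ≫ blowupMap n Q = 𝟙 Q) :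
    ∃! e : Q ≅ blowup n P, e.hom ≫ blowupMap n P = q := by
  have h1 {E F : RelPrecubicalSet.{w}} {p : E ⟶ F} (hp : (generatingCofibrations.{w} n).rlp p) :=
    liftsUniquely_of_exists_section hp hQ
  have h2 {E F : RelPrecubicalSet.{w}} {p : E ⟶ F} (hp : (generatingCofibrations.{w} n).rlp p) :=
    liftsUniquely_of_exists_section (P := blowup n P) hp ⟨_, blowupSection_comp_blowupMap⟩
  have hβ := blowupMap_mem_rlp n P
  obtain ⟨u, hu, -⟩ := h1 hβ q
  obtain ⟨v, hv, -⟩ := h2 hq (blowupMap n P)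
  refine ⟨⟨u, v, (h1 hq).hom_ext ?_, (h2 hβ).hom_ext ?_⟩, hu, fun e he => ?_⟩
  · rw [Category.assoc, hv, hu, Category.id_comp]
  · rw [Category.assoc, hu, hv, Category.id_comp]
  · exact Iso.ext ((h1 hβ).hom_ext (he.trans hu.symm))

theorem isEuclidean_iff_exists_section (P : RelPrecubicalSet.{w}) :
    IsEuclidean n P ↔ ∃ s : P ⟶ blowup n P, s ≫ blowupMap n P = 𝟙 P := by
  refine ⟨fun h => h.exists_section, fun h => ?_⟩
  -- With `q = 𝟙 P`, the section makes `P` its own cofibrant replacement, hence isomorphic to its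
  -- blowup.
  obtain ⟨e, -, -⟩ := existsUnique_iso_blowup (MorphismProperty.id_mem _ P) h
  exact (isEuclidean_blowup n P).of_iso e.symm

theorem isIso_of_llp_of_mem {E F : RelPrecubicalSet.{w}} {T : MorphismProperty RelPrecubicalSet.{w}}
    {p : E ⟶ F} (h : T.llp p) (h' : T p) : IsIso p := by
  have := h p h'
  have sq : CommSq (𝟙 E) p p (𝟙 F) := ⟨by simp⟩
  exact ⟨sq.lift, sq.fac_left, sq.fac_right⟩

/-- The `n`-euclidean model structure. -/
theorem exists_modelCategory (n : ℕ) : ∃ _ : ModelCategory RelPrecubicalSet.{w},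
    cofibrations RelPrecubicalSet.{w} = (generatingCofibrations.{w} n).rlp.llp ∧
    fibrations RelPrecubicalSet.{w} = ⊤ ∧
    weakEquivalences RelPrecubicalSet.{w} = (generatingCofibrations.{w} n).rlp := by
  let _ : CategoryWithCofibrations RelPrecubicalSet.{w} := ⟨(generatingCofibrations.{w} n).rlp.llp⟩
  let _ : CategoryWithFibrations RelPrecubicalSet.{w} := ⟨⊤⟩
  let _ : CategoryWithWeakEquivalences RelPrecubicalSet.{w} := ⟨(generatingCofibrations.{w} n).rlp⟩
  have e : trivialFibrations RelPrecubicalSet.{w} = (generatingCofibrations.{w} n).rlp :=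
    top_inf_eq _
  -- A morphism that lifts against itself is invertible, so the trivial cofibrations are the
  -- isomorphisms and every morphism can be a fibration.
  have e' : trivialCofibrations RelPrecubicalSet.{w} =
      MorphismProperty.isomorphisms RelPrecubicalSet.{w} := by
    ext E F p
    constructor
    · rintro ⟨h, h'⟩
      exact isIso_of_llp_of_mem h h'
    · intro (h : IsIso p)
      exact ⟨MorphismProperty.llp_of_isIso _ p, MorphismProperty.rlp_of_isIso _ p⟩
  have : (weakEquivalences RelPrecubicalSet.{w}).HasTwoOutOfThreeProperty :=
    hasTwoOutOfThreeProperty_rlp n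
  have : MorphismProperty.IsWeakFactorizationSystem (cofibrations RelPrecubicalSet.{w})
      (trivialFibrations RelPrecubicalSet.{w}) := by
    rw [e]
    exact
      { rlp := MorphismProperty.rlp_llp_rlp _
        llp := rfl
        hasFactorization := ⟨fun f => by
          obtain ⟨Z, i, p, h1, h2, h3⟩ := exists_factorization n f
          exact ⟨⟨Z, i, p, h1, h2, h3⟩⟩⟩ }
  have : MorphismProperty.IsWeakFactorizationSystem (trivialCofibrations RelPrecubicalSet.{w})
      (fibrations RelPrecubicalSet.{w}) := by
    rw [e']
    exact
      { rlp := by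
          ext E F p
          exact ⟨fun _ => trivial, fun _ A B i (hi : IsIso i) => inferInstance⟩
        llp := by
          ext E F p
          exact ⟨fun h => isIso_of_llp_of_mem h trivial,
            fun (h : IsIso p) => MorphismProperty.llp_of_isIso _ p⟩
        hasFactorization := ⟨fun f =>
          ⟨⟨_, 𝟙 _, f, Category.id_comp f, MorphismProperty.id_mem _ _, trivial⟩⟩⟩ }
  exact ⟨ModelCategory.mk' _, rfl, rfl, rfl⟩

end RelPrecubicalSet

theorem mainTheorem1 (n : ℕ) :
    ∃ _ : ModelCategory RelPrecubicalSet.{w},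
      cofibrations RelPrecubicalSet.{w} =
        (RelPrecubicalSet.generatingCofibrations.{w} n).rlp.llp ∧
      fibrations RelPrecubicalSet.{w} = ⊤ ∧
      weakEquivalences RelPrecubicalSet.{w} =
        (RelPrecubicalSet.generatingCofibrations.{w} n).rlp ∧
      (∀ P : RelPrecubicalSet.{w}, IsCofibrant P ↔ RelPrecubicalSet.IsEuclidean n P) ∧
      ∀ P : RelPrecubicalSet.{w},
        IsCofibrant (RelPrecubicalSet.blowup n P) ∧
        trivialFibrations RelPrecubicalSet.{w} (RelPrecubicalSet.blowupMap n P) ∧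
        ∀ (Q : RelPrecubicalSet.{w}) (q : Q ⟶ P), IsCofibrant Q →
          trivialFibrations RelPrecubicalSet.{w} q →
          ∃! e : Q ≅ RelPrecubicalSet.blowup n P,
            e.hom ≫ RelPrecubicalSet.blowupMap n P = q := by
  obtain ⟨M, hc, hf, hw⟩ := RelPrecubicalSet.exists_modelCategory.{w} n
  have hcof (P : RelPrecubicalSet.{w}) : IsCofibrant P ↔
      ∃ s : P ⟶ RelPrecubicalSet.blowup n P, s ≫ RelPrecubicalSet.blowupMap n P = 𝟙 P := by
    rw [isCofibrant_iff, cofibration_iff, hc]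
    exact RelPrecubicalSet.llp_initial_iff P
  have htriv : trivialFibrations RelPrecubicalSet.{w} =
      (RelPrecubicalSet.generatingCofibrations.{w} n).rlp := by
    rw [trivialFibrations, hf, hw, top_inf_eq]
  refine ⟨M, hc, hf, hw,
    fun P => (hcof P).trans (RelPrecubicalSet.isEuclidean_iff_exists_section P).symm, fun P =>
    ⟨(hcof _).2 ⟨_, RelPrecubicalSet.blowupSection_comp_blowupMap⟩, ?_, fun Q q hQ hq => ?_⟩⟩
  · rw [htriv]
    exact RelPrecubicalSet.blowupMap_mem_rlp n P
  · rw [htriv] at hq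
    exact RelPrecubicalSet.existsUnique_iso_blowup hq ((hcof Q).1 hQ)
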